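/- Congested Clique model: the $n$ vertices of the input graph are players; initially a player knows $n$, its own ID, its incident edges and their weights. Computation proceeds in synchronous rounds; in each round every player performs unrestricted local computation and may send to each player one message of $O(\log n)$ bits. The message complexity is the total number of messages sent. Edge weights are integers of absolute value at most $n^{c}$ for a constant $c$; the constant in the message length $O(\log n)$ may depend on $c$, all other constants below are absolute. Lemma. There is a deterministic $O(1)$-round Congested Clique algorithm that, for every simple weighted graph $G$ with $n$ vertices and $m$ edges, sends $O(m)$ messages in total and reduces the minimum spanning forest problem on $G$ to the minimum spanning forest problem on a simple weighted graph $G'$ with $O(n)$ vertices and $O(\sqrt{mn})$ edges, whose weights are integers of absolute value $O(n^{c})$, and which is connected whenever $G$ is connected (so that a minimum spanning tree instance is reduced to a minimum spanning tree instance). Here the reduction means the following. Each vertex of $G'$ is assigned to one player that simulates it, the vertices simulated by any one player have total degree $O(n)$ in $G'$, and some edges of $G'$ are labelled with edges of $G$. At the end every player knows exactly the vertices of $G'$ that it simulates and all edges of $G'$ incident to them, for each such edge with its weight, its other endpoint, the player simulating that endpoint, and the label, if any. For every minimum spanning forest $T'$ of $G'$, the set of the labels of the edges of $T'$ is a minimum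 spanning forest of $G$. -/

import Mathlib

/-! Weighted graphs, minimum spanning forests, and the Congested Clique model. -/

/-- An instance of the minimum spanning tree / forest problem with vertex set `V`:
a simple graph with integer edge weights (values of `weight` off the edge set are irrelevant). -/
structure WeightedGraph (V : Type) where
  graph : SimpleGraph V
  weight : Sym2 V → ℤ

namespace WeightedGraph

variable {V : Type}

/-- The number of edges. -/
noncomputable def numEdges (G : WeightedGraph V) : ℕ := G.graph.edgeSet.ncard

/-- `T` is a set of edges of `G`, it contains no cycle, and it connects any two vertices that are
connected in `G`. If `G` is connected, then these are the edge sets of the spanning trees. -/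
structure IsSpanningForest (G : WeightedGraph V) (T : Finset (Sym2 V)) : Prop where
  subset : (T : Set (Sym2 V)) ⊆ G.graph.edgeSet
  acyclic : (SimpleGraph.fromEdgeSet (T : Set (Sym2 V))).IsAcyclic
  reachable : ∀ u v : V, G.graph.Reachable u v →
    (SimpleGraph.fromEdgeSet (T : Set (Sym2 V))).Reachable u v

/-- A spanning forest of minimum total weight; a minimum spanning tree if `G` is connected. -/
def IsMinSpanningForest (G : WeightedGraph V) (T : Finset (Sym2 V)) : Prop :=
  G.IsSpanningForest T ∧
    ∀ T' : Finset (Sym2 V), G.IsSpanningForest T' → ∑ e ∈ T, G.weight e ≤ ∑ e ∈ T', G.weight e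

open Classical in
/-- What the player of vertex `v` knows initially: for every `u`, whether `v` and `u` are adjacent
and, if so, the weight of the edge between them. -/
noncomputable def localInput (G : WeightedGraph V) (v : V) : V → Option ℤ :=
  fun u => if G.graph.Adj v u then some (G.weight s(v, u)) else none

end WeightedGraph

/-- A deterministic algorithm for the Congested Clique with players `Fin n` and messages of
`w` bits. Local computation is unrestricted. In each of the `rounds` synchronous rounds, every
player decides from its current state, for each player, whether to send it a message and which
one (`none` means that no message is sent), and then updates its state from the messages
received. -/
structure CliqueAlgorithm (n w : ℕ) (Input Output : Type) where
  rounds : ℕ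
  State : Type
  init : Fin n → Input → State
  send : Fin n → State → Fin n → Option (BitVec w)
  step : Fin n → State → (Fin n → Option (BitVec w)) → State
  output : Fin n → State → Output

namespace CliqueAlgorithm

variable {n w : ℕ} {Input Output : Type}

/-- The state of each player after `t` rounds. -/
def stateAt (A : CliqueAlgorithm n w Input Output) (input : Fin n → Input) :
    ℕ → Fin n → A.State
  | 0, v => A.init v (input v)
  | t + 1, v => A.step v (A.stateAt input t v) (fun u => A.send u (A.stateAt input t u) v)

/-- The message, if any, that `u` sends to `v` in round `t` (rounds are numbered from `0`). -/
def messageAt (A : CliqueAlgorithm n w Input Output) (input : Fin n → Input)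
    (t : ℕ) (u v : Fin n) : Option (BitVec w) :=
  A.send u (A.stateAt input t u) v

/-- The total number of messages sent by all players in all rounds. -/
def messageCount (A : CliqueAlgorithm n w Input Output) (input : Fin n → Input) : ℕ :=
  ∑ t ∈ Finset.range A.rounds,
    (Finset.univ.filter fun p : Fin n × Fin n => (A.messageAt input t p.1 p.2).isSome).card

/-- The output of each player after the last round. -/
def result (A : CliqueAlgorithm n w Input Output) (input : Fin n → Input) (v : Fin n) : Output :=
  A.output v (A.stateAt input A.rounds v)

end CliqueAlgorithm

/-- What the player simulating `src` records about an edge from `src` to `tgt`: the player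
simulating `tgt`, the weight of the edge, and the edge of the original graph
(if any) that it stands for. -/
structure EdgeRecord (n : ℕ) where
  src : ℕ
  tgt : ℕ
  tgtHost : Fin n
  weight : ℤ
  origin : Option (Sym2 (Fin n))

/-- The part of an instance that is held by one player: the names of the vertices
that it simulates, and the records of the edges incident to them. -/
structure LocalView (n : ℕ) where
  vertices : Set ℕ
  edges : Set (EdgeRecord n)

/-- An instance with vertices `0, …, size - 1`, each of which is simulated by
one of `n` players. Each of its edges may stand for an edge of an original graph on `Fin n`. -/
structure HostedInstance (n : ℕ) where
  size : ℕ
  inst : WeightedGraph (Fin size)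
  host : Fin size → Fin n
  origin : Sym2 (Fin size) → Option (Sym2 (Fin n))

namespace HostedInstance

variable {n : ℕ}

/-- What player `v` has to know: exactly the vertices that it simulates and all the edges
incident to them. -/
def localView (D : HostedInstance n) (v : Fin n) : LocalView n where
  vertices := {x | ∃ a : Fin D.size, D.host a = v ∧ x = (a : ℕ)}
  edges := {r | ∃ a b : Fin D.size, D.inst.graph.Adj a b ∧ D.host a = v ∧
    r = ⟨(a : ℕ), (b : ℕ), D.host b, D.inst.weight s(a, b), D.origin s(a, b)⟩}

/-- The sum of the degrees of the vertices that player `v` simulates. -/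
noncomputable def load (D : HostedInstance n) (v : Fin n) : ℕ :=
  ∑ a ∈ Finset.univ.filter (fun a => D.host a = v), (D.inst.graph.neighborSet a).ncard

/-- The set of the edges of the original graph that the edges in `T` stand for. -/
def recover (D : HostedInstance n) (T : Finset (Sym2 (Fin D.size))) : Finset (Sym2 (Fin n)) :=
  T.biUnion fun e => (D.origin e).toFinset

end HostedInstance

/-! The instance $G'$ is a subgraph of $G$ on the same vertices; each player simulates its own
vertex, and each edge is its own label. It suffices that the ends of every edge $e$ of $G$ are
joined in $G'$ by edges not heavier than $e$ (`IsBottleneckSubgraph`): exchanges then move any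
spanning forest of $G$ into $G'$ without raising its weight. This property can be secured piecewise:
split the darts (ordered adjacent pairs) into parts and keep a Kruskal forest of each part
(`exists_sparse_bottleneck`), which has at most as many edges as the part touches vertices.

Let $M = 2m$ be the number of darts and $g = \lfloor\sqrt{\lfloor M/n\rfloor}\rfloor$. If $g = 0$,
then $m \le n$ and $G$ itself is sparse enough. Otherwise the vertices are grouped by residue modulo
$g$, the darts from $u$ to group $j$ form the block $(u,j)$, and the blocks from group $i$ to group
$j$ are cut into parts of at most $2n$ darts. A part touches two groups, so $O(n/g)$ vertices, and
there are at most $g^2 + M/n = O(g^2)$ parts; hence $O(gn) = O(\sqrt{mn})$ darts are kept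
(`card_keptDarts_numGroups_le`).

A holder must collect each part without overloading a link. Each dart gets a slot below $7n$ and
travels through the player whose number is the slot modulo $n$. In every group a center chooses
start times for the blocks so that darts of one vertex or of one part have distinct slots
(`exists_start_times`, `exists_isPlan`, `eq_of_slot_eq`); then every link carries $O(1)$ items per
round (`card_protocol_le`). The coordination handles $gn \le g^2 n \le M$ blocks, so each round
sends at most $M$ messages (`card_protocol_nonempty_le`).

Messages are defined as functions of the whole graph. `protocol_local` shows that each depends only
on what its sender has seen, and `exists_of_finset_schedule` turns such a schedule into an
algorithm. -/

open Finset

/-! ### Reachability, cuts and adding an edge. -/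

namespace SimpleGraph

variable {V : Type*}

theorem Reachable.of_sup_edge {G : SimpleGraph V} {x y u v : V}
    (h : (G ⊔ edge x y).Reachable u v) :
    G.Reachable u v ∨ (G.Reachable u x ∧ G.Reachable y v) ∨
      (G.Reachable u y ∧ G.Reachable x v) := by
  obtain ⟨p⟩ := h
  induction p with
  | nil => exact Or.inl (Reachable.refl _)
  | @cons u v w hadj p ih =>
    rw [sup_adj, edge_adj] at hadj
    rcases hadj with hadj | ⟨⟨rfl, rfl⟩ | ⟨rfl, rfl⟩, -⟩
    · have hr : G.Reachable u v := hadj.reachable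
      rcases ih with h | ⟨h1, h2⟩ | ⟨h1, h2⟩
      · exact Or.inl (hr.trans h)
      · exact Or.inr (Or.inl ⟨hr.trans h1, h2⟩)
      · exact Or.inr (Or.inr ⟨hr.trans h1, h2⟩)
    · rcases ih with h | ⟨h1, h2⟩ | ⟨h1, h2⟩
      · exact Or.inr (Or.inl ⟨Reachable.refl _, h⟩)
      · exact Or.inr (Or.inl ⟨Reachable.refl _, h2⟩)
      · exact Or.inl h2
    · rcases ih with h | ⟨h1, h2⟩ | ⟨h1, h2⟩
      · exact Or.inr (Or.inr ⟨Reachable.refl _, h⟩)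
      · exact Or.inl h2
      · exact Or.inr (Or.inr ⟨Reachable.refl _, h2⟩)

/-- A walk that leaves a set of vertices has an edge that leaves it. -/
theorem Reachable.exists_adj_crossing {G : SimpleGraph V} {x y : V} (h : G.Reachable x y)
    (P : V → Prop) (hx : P x) (hy : ¬ P y) : ∃ a b, G.Adj a b ∧ P a ∧ ¬ P b := by
  obtain ⟨p⟩ := h
  induction p with
  | nil => exact absurd hx hy
  | @cons u v w hadj p ih =>
    by_cases hv : P v
    · exact ih hv hy
    · exact ⟨u, v, hadj, hx, hv⟩

theorem Reachable.of_forall_adj {G H : SimpleGraph V}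
    (h : ∀ a b, G.Adj a b → H.Reachable a b) {u v : V} (huv : G.Reachable u v) :
    H.Reachable u v := by
  obtain ⟨p⟩ := huv
  induction p with
  | nil => exact Reachable.refl _
  | cons hadj p ih => exact (h _ _ hadj).trans ih

theorem fromEdgeSet_insert_pair (T : Set (Sym2 V)) (x y : V) :
    fromEdgeSet (insert s(x, y) T) = fromEdgeSet T ⊔ edge x y := by
  ext a b
  simp only [fromEdgeSet_adj, sup_adj, edge_adj, Set.mem_insert_iff, Sym2.eq_iff]
  tauto

end SimpleGraph

open SimpleGraph

/-! ### Bottleneck subgraphs preserve minimum spanning forests. -/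

namespace WeightedGraph

/-- The spanning subgraph `H` keeps the weights and joins the endpoints of every edge `e` of `G`
by a path whose edges are not heavier than `e`. -/
structure IsBottleneckSubgraph {V : Type} (G : WeightedGraph V) (H : SimpleGraph V) : Prop where
  le : H ≤ G.graph
  reachable : ∀ x y, G.graph.Adj x y →
    (fromEdgeSet {f | f ∈ H.edgeSet ∧ G.weight f ≤ G.weight s(x, y)}).Reachable x y

variable {V : Type} {G : WeightedGraph V} {H : SimpleGraph V}

theorem IsBottleneckSubgraph.reachable_of_reachable (h : G.IsBottleneckSubgraph H) {u v : V}
    (huv : G.graph.Reachable u v) : H.Reachable u v := by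
  refine huv.of_forall_adj fun a b hab => (h.reachable a b hab).mono ?_
  intro x y hxy
  exact ((fromEdgeSet_adj _).1 hxy).1.1

/-- Deleting `e` separates its ends in the forest, so the light path between them in `H` has an edge
leaving the component of one end; that edge is `f`. It may be `e` itself. -/
theorem IsSpanningForest.exchange [DecidableEq V] (h : G.IsBottleneckSubgraph H)
    {T : Finset (Sym2 V)} (hT : G.IsSpanningForest T) {e : Sym2 V} (heT : e ∈ T) :
    ∃ f ∈ H.edgeSet, f ∉ T.erase e ∧ G.weight f ≤ G.weight e ∧
      G.IsSpanningForest (insert f (T.erase e)) := by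
  induction e using Sym2.ind with
  | _ x y =>
  set T₀ : Finset (Sym2 V) := T.erase s(x, y) with hT₀
  have hGxy : G.graph.Adj x y := hT.subset heT
  have hins : (T : Set (Sym2 V)) = insert s(x, y) (T₀ : Set (Sym2 V)) := by
    rw [← Finset.coe_insert, hT₀, Finset.insert_erase heT]
  have hTgraph : fromEdgeSet (T : Set (Sym2 V)) = fromEdgeSet (T₀ : Set (Sym2 V)) ⊔ edge x y := by
    rw [hins, fromEdgeSet_insert_pair]
  have hacy₀ : (fromEdgeSet (T₀ : Set (Sym2 V))).IsAcyclic :=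
    hT.acyclic.anti (by rw [hTgraph]; exact le_sup_left)
  have hTadj : (fromEdgeSet (T : Set (Sym2 V))).Adj x y :=
    (fromEdgeSet_adj _).2 ⟨heT, hGxy.ne⟩
  have hnxy : ¬ (fromEdgeSet (T₀ : Set (Sym2 V))).Reachable x y := by
    have hb := isAcyclic_iff_forall_adj_isBridge.1 hT.acyclic hTadj
    rw [isBridge_iff] at hb
    convert hb using 2
    rw [hT₀, Finset.coe_erase]
    ext a b
    simp [deleteEdges, fromEdgeSet_adj]
  obtain ⟨a, b, hab, hxa, hxb⟩ := (h.reachable x y hGxy).exists_adj_crossing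
    (fun v => (fromEdgeSet (T₀ : Set (Sym2 V))).Reachable x v) (Reachable.refl _) hnxy
  obtain ⟨⟨habH, hw⟩, hne⟩ := (fromEdgeSet_adj _).1 hab
  have hnab : ¬ (fromEdgeSet (T₀ : Set (Sym2 V))).Reachable a b := fun hr => hxb (hxa.trans hr)
  have habG : G.graph.Adj a b := h.le habH
  -- `T` connects `a` and `b` but `T₀` does not, so the connection uses the edge `xy`; as `b` is not
  -- on the side of `x`, it is on the side of `y`.
  have hby : (fromEdgeSet (T₀ : Set (Sym2 V))).Reachable b y := by
    have hr := hT.reachable a b habG.reachable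
    rw [hTgraph] at hr
    rcases hr.of_sup_edge with h1 | ⟨-, h1⟩ | ⟨-, h1⟩
    · exact absurd h1 hnab
    · exact h1.symm
    · exact absurd h1 hxb
  have hnew : fromEdgeSet ((insert s(a, b) T₀ : Finset (Sym2 V)) : Set (Sym2 V)) =
      fromEdgeSet (T₀ : Set (Sym2 V)) ⊔ edge a b := by
    rw [Finset.coe_insert, fromEdgeSet_insert_pair]
  refine ⟨s(a, b), habH, fun hmem => hnab ?_, hw, ?_, ?_, ?_⟩
  · exact Adj.reachable ((fromEdgeSet_adj _).2 ⟨hmem, hne⟩)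
  · rw [Finset.coe_insert]
    refine Set.insert_subset habG ((Finset.coe_subset.2 (Finset.erase_subset _ _)).trans hT.subset)
  · rw [hnew]
    exact hacy₀.sup_edge_of_not_reachable hnab
  · intro u v huv
    refine Reachable.of_forall_adj ?_ (hT.reachable u v huv)
    intro c d hcd
    rw [hTgraph, sup_adj, edge_adj] at hcd
    rw [hnew]
    have hmono : fromEdgeSet (T₀ : Set (Sym2 V)) ≤ fromEdgeSet (T₀ : Set (Sym2 V)) ⊔ edge a b :=
      le_sup_left
    have hxy' : (fromEdgeSet (T₀ : Set (Sym2 V)) ⊔ edge a b).Reachable x y := by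
      refine (hxa.mono hmono).trans (Reachable.trans (Adj.reachable ?_) (hby.mono hmono))
      rw [sup_adj, edge_adj]
      exact Or.inr ⟨Or.inl ⟨rfl, rfl⟩, hne⟩
    rcases hcd with hcd | ⟨⟨rfl, rfl⟩ | ⟨rfl, rfl⟩, -⟩
    · exact hcd.reachable.mono hmono
    · exact hxy'
    · exact hxy'.symm

/-- Each exchange lowers the number of forest edges outside `H` by one. -/
theorem IsBottleneckSubgraph.exists_spanningForest_le (h : G.IsBottleneckSubgraph H)
    (T : Finset (Sym2 V)) (hT : G.IsSpanningForest T) :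
    ∃ T' : Finset (Sym2 V), (T' : Set (Sym2 V)) ⊆ H.edgeSet ∧ G.IsSpanningForest T' ∧
      ∑ e ∈ T', G.weight e ≤ ∑ e ∈ T, G.weight e := by
  classical
  induction hk : (T.filter (· ∉ H.edgeSet)).card generalizing T with
  | zero =>
    refine ⟨T, fun e he => ?_, hT, le_rfl⟩
    by_contra hne
    have := Finset.card_eq_zero.1 hk
    exact Finset.notMem_empty e (this ▸ Finset.mem_filter.2 ⟨he, hne⟩)
  | succ k ih =>
    obtain ⟨e, he⟩ : (T.filter (· ∉ H.edgeSet)).Nonempty := by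
      rw [← Finset.card_pos]; omega
    obtain ⟨heT, heH⟩ := Finset.mem_filter.1 he
    obtain ⟨f, hfH, hfT, hw, hforest⟩ := hT.exchange h heT
    have hcard : ((insert f (T.erase e)).filter (· ∉ H.edgeSet)).card = k := by
      rw [Finset.filter_insert, if_neg (not_not.2 hfH), Finset.filter_erase,
        Finset.card_erase_of_mem he, hk]
      rfl
    obtain ⟨T', h1, h2, h3⟩ := ih _ hforest hcard
    refine ⟨T', h1, h2, h3.trans ?_⟩
    rw [Finset.sum_insert hfT, ← Finset.add_sum_erase T _ heT]
    linarith

theorem IsBottleneckSubgraph.isMinSpanningForest (h : G.IsBottleneckSubgraph H)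
    {T : Finset (Sym2 V)} (hT : (⟨H, G.weight⟩ : WeightedGraph V).IsMinSpanningForest T) :
    G.IsMinSpanningForest T := by
  obtain ⟨hT, hmin⟩ := hT
  refine ⟨⟨fun e he => ?_, hT.acyclic, fun u v huv =>
    hT.reachable u v (h.reachable_of_reachable huv)⟩, fun T' hT' => ?_⟩
  · exact edgeSet_mono h.le (hT.subset he)
  · obtain ⟨T'', h1, h2, h3⟩ := h.exists_spanningForest_le T' hT'
    refine le_trans (hmin T'' ⟨h1, h2.acyclic, fun u v huv => h2.reachable u v (huv.mono h.le)⟩) h3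

end WeightedGraph

/-! ### Kruskal selection. -/

/-- Kruskal's algorithm: every finite family of weighted edges contains a sparse subfamily that
joins the endpoints of each edge `e` of the family by edges that are not heavier than `e`. -/
theorem exists_sparse_bottleneck {V ι : Type*} (a b : ι → V) (w : ι → ℤ) (S : Finset ι) :
    ∃ F ⊆ S, (∀ e ∈ S, (fromEdgeSet {x | ∃ f ∈ F, w f ≤ w e ∧ x = s(a f, b f)}).Reachable
      (a e) (b e)) ∧ ∀ W : Finset V, (∀ e ∈ S, a e ∈ W ∧ b e ∈ W) → F.card ≤ W.card := by
  classical
  let K : Finset ι → SimpleGraph V := fun F => fromEdgeSet {x | ∃ f ∈ F, x = s(a f, b f)}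
  -- The bound is strengthened by the number of components that `W` meets, since each selected edge
  -- merges two of them.
  suffices h : ∃ F ⊆ S, (∀ e ∈ S,
      (fromEdgeSet {x | ∃ f ∈ F, w f ≤ w e ∧ x = s(a f, b f)}).Reachable (a e) (b e)) ∧
      ∀ W : Finset V, (∀ e ∈ S, a e ∈ W ∧ b e ∈ W) →
        F.card + (W.image (K F).connectedComponentMk).card ≤ W.card by
    obtain ⟨F, h1, h2, h3⟩ := h
    exact ⟨F, h1, h2, fun W hW => (Nat.le_add_right _ _).trans (h3 W hW)⟩
  induction S using Finset.induction_on_max_value w with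
  | empty =>
    refine ⟨∅, le_rfl, by simp, fun W _ => ?_⟩
    simpa using Finset.card_image_le
  | insert e S heS hmax ih =>
    obtain ⟨F, hFS, hreach, hcard⟩ := ih
    by_cases hr : (K F).Reachable (a e) (b e)
    · refine ⟨F, hFS.trans (Finset.subset_insert _ _), ?_, fun W hW =>
        hcard W fun f hf => hW f (Finset.mem_insert_of_mem hf)⟩
      intro f hf
      rcases Finset.mem_insert.1 hf with rfl | hf
      · refine hr.mono (fromEdgeSet_mono ?_)
        rintro x ⟨f', hf', rfl⟩
        exact ⟨f', hf', hmax f' (hFS hf'), rfl⟩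
      · exact hreach f hf
    · have heF : e ∉ F := fun h => heS (hFS h)
      have hle : K F ≤ K (insert e F) := by
        refine fromEdgeSet_mono ?_
        rintro x ⟨f', hf', rfl⟩
        exact ⟨f', Finset.mem_insert_of_mem hf', rfl⟩
      have hadj : (K (insert e F)).Adj (a e) (b e) := by
        refine (fromEdgeSet_adj _).2 ⟨⟨e, Finset.mem_insert_self _ _, rfl⟩, ?_⟩
        intro h
        exact hr (h ▸ Reachable.refl _)
      refine ⟨insert e F, Finset.insert_subset_insert _ hFS, ?_, fun W hW => ?_⟩
      · intro f hf
        rcases Finset.mem_insert.1 hf with rfl | hf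
        · exact Adj.reachable ((fromEdgeSet_adj _).2
            ⟨⟨_, Finset.mem_insert_self _ _, le_rfl, rfl⟩, hadj.ne⟩)
        · refine (hreach f hf).mono (fromEdgeSet_mono ?_)
          rintro x ⟨f', hf', h, rfl⟩
          exact ⟨f', Finset.mem_insert_of_mem hf', h, rfl⟩
      · have h1 := hcard W fun f hf => hW f (Finset.mem_insert_of_mem hf)
        have himg : W.image (K (insert e F)).connectedComponentMk =
            (W.image (K F).connectedComponentMk).image
              (ConnectedComponent.map (Hom.ofLE hle)) := by
          rw [Finset.image_image]
          rfl
        have hlt : (W.image (K (insert e F)).connectedComponentMk).card <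
            (W.image (K F).connectedComponentMk).card := by
          rw [himg]
          -- Equal cardinalities would make the map of components injective on those met by `W`, but
          -- it identifies the components of the two ends of `e`.
          refine lt_of_le_of_ne Finset.card_image_le fun heq => ?_
          have hinj := Finset.card_image_iff.1 heq
          obtain ⟨ha, hb⟩ := hW e (Finset.mem_insert_self _ _)
          refine hr (ConnectedComponent.exact (hinj (Finset.mem_coe.2 (Finset.mem_image_of_mem _ ha))
            (Finset.mem_coe.2 (Finset.mem_image_of_mem _ hb)) ?_))
          exact ConnectedComponent.sound hadj.reachable
        rw [Finset.card_insert_of_notMem heF]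
        omega

/-! ### Algorithms from message schedules -/

namespace CliqueAlgorithm

/-- After `t` rounds of the message schedule `μ`, player `u` cannot distinguish `G` from `G'`. -/
def SameView {n : ℕ} {𝒢 Input M : Type} (input : 𝒢 → Fin n → Input)
    (μ : ℕ → 𝒢 → Fin n → Fin n → M) (t : ℕ) (G G' : 𝒢) (u : Fin n) : Prop :=
  input G u = input G' u ∧ ∀ t' < t, ∀ v, μ t' G v u = μ t' G' v u

theorem SameView.mono {n : ℕ} {𝒢 Input M : Type} {input : 𝒢 → Fin n → Input}
    {μ : ℕ → 𝒢 → Fin n → Fin n → M} {s t : ℕ} {G G' : 𝒢} {u : Fin n}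
    (h : SameView input μ t G G' u) (hst : s ≤ t) : SameView input μ s G G' u :=
  ⟨h.1, fun t' ht' => h.2 t' (ht'.trans_le hst)⟩

/-- A schedule in which every message and every output depends only on what its player has seen
so far is carried out by an algorithm. -/
theorem exists_of_schedule {n w : ℕ} {𝒢 Input Output : Type}
    (input : 𝒢 → Fin n → Input) (R : ℕ) (μ : ℕ → 𝒢 → Fin n → Fin n → Option (BitVec w))
    (out : 𝒢 → Fin n → Output)
    (hμ : ∀ t < R, ∀ G G' u, SameView input μ t G G' u → μ t G u = μ t G' u)
    (hout : ∀ G G' u, SameView input μ R G G' u → out G u = out G' u) [Nonempty Output] :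
    ∃ A : CliqueAlgorithm n w Input Output, A.rounds = R ∧ ∀ G,
      A.messageCount (input G) = ∑ t ∈ range R,
        (univ.filter fun p : Fin n × Fin n => (μ t G p.1 p.2).isSome).card ∧
      ∀ v, A.result (input G) v = out G v := by
  classical
  let hist : 𝒢 → ℕ → Fin n → ℕ → Fin n → Option (BitVec w) :=
    fun G t v t' u => if t' < t then μ t' G u v else none
  have hview : ∀ {t G G' v}, input G v = input G' v → hist G t v = hist G' t v →
      SameView input μ t G G' v := by
    intro t G G' v h1 h2
    refine ⟨h1, fun t' ht' u => ?_⟩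
    have := congrFun (congrFun h2 t') u
    simpa [hist, ht'] using this
  let A : CliqueAlgorithm n w Input Output :=
    { rounds := R
      State := ℕ × Input × (ℕ → Fin n → Option (BitVec w))
      init := fun _ i => (0, i, fun _ _ => none)
      -- The player acts as for an arbitrary graph consistent with its state; by `hμ` all such
      -- graphs prescribe the same messages.
      send := fun v s =>
        if h : ∃ G, input G v = s.2.1 ∧ hist G s.1 v = s.2.2 then μ s.1 h.choose v
        else fun _ => none
      step := fun _ s r => (s.1 + 1, s.2.1, Function.update s.2.2 s.1 r)
      output := fun v s =>
        if h : ∃ G, input G v = s.2.1 ∧ hist G s.1 v = s.2.2 then out h.choose v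
        else Classical.arbitrary Output }
  have hsend : ∀ G t v, t < R → A.send v (t, input G v, hist G t v) = μ t G v := by
    intro G t v ht
    have hex : ∃ G', input G' v = input G v ∧ hist G' t v = hist G t v := ⟨G, rfl, rfl⟩
    change (if h : ∃ G', input G' v = input G v ∧ hist G' t v = hist G t v
      then μ t h.choose v else fun _ => none) = _
    rw [dif_pos hex]
    exact hμ t ht _ _ _ (hview hex.choose_spec.1 hex.choose_spec.2)
  have hstate : ∀ G t v, t ≤ R → A.stateAt (input G) t v = (t, input G v, hist G t v) := by
    intro G t
    induction t with
    | zero =>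
      intro v _
      simp [stateAt, hist, A]
    | succ t ih =>
      intro v ht
      have hr : (fun u => A.send u (A.stateAt (input G) t u) v) = fun u => μ t G u v := by
        funext u
        rw [ih u (by omega), hsend G t u (by omega)]
      rw [stateAt, hr, ih v (by omega)]
      change (t + 1, input G v, Function.update (hist G t v) t _) = _
      congr 2
      funext t' u
      rcases eq_or_ne t' t with rfl | hne
      · simp [hist]
      · have : t' < t + 1 ↔ t' < t := by omega
        simp [hist, Function.update_of_ne hne, this]
  refine ⟨A, rfl, fun G => ⟨?_, fun v => ?_⟩⟩
  · refine Finset.sum_congr rfl fun t ht => ?_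
    have ht' : t < R := Finset.mem_range.1 ht
    congr 1
    refine Finset.filter_congr fun p _ => ?_
    rw [messageAt, hstate G t _ ht'.le, hsend G t _ ht']
  · have hex : ∃ G', input G' v = input G v ∧ hist G' R v = hist G R v := ⟨G, rfl, rfl⟩
    change A.output v (A.stateAt (input G) R v) = _
    rw [hstate G R v le_rfl]
    change (if h : ∃ G', input G' v = input G v ∧ hist G' R v = hist G R v
      then out h.choose v else _) = _
    rw [dif_pos hex]
    exact hout _ _ _ (hview hex.choose_spec.1 hex.choose_spec.2)

end CliqueAlgorithm

/-! ### Encoding small sets of items in bit strings. -/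

/-- There are few small subsets of a finite set. -/
theorem exists_injOn_bitVec {α : Type*} (box : Finset α) (L w : ℕ)
    (h : (box.card + 1) ^ L ≤ 2 ^ w) :
    ∃ code : Finset α → BitVec w, Set.InjOn code {s | s ⊆ box ∧ s.card ≤ L} := by
  classical
  -- A set is listed in `L` places, the unused ones being `none`; this gives the base `box.card +
  -- 1`.
  let D := Fin L → Option box
  have hcard : Fintype.card D ≤ Fintype.card (BitVec w) := by
    rw [Fintype.card_congr BitVec.equivFin.toEquiv]
    simpa [D] using h
  obtain ⟨φ⟩ := Function.Embedding.nonempty_of_card_le hcard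
  have hrep : ∀ s : Finset α, s ⊆ box ∧ s.card ≤ L →
      ∃ f : D, ∀ x, x ∈ s ↔ ∃ i, (f i).map Subtype.val = some x := by
    rintro s ⟨hs, hL⟩
    refine ⟨fun i => if hi : (i : ℕ) < s.card then
      some ⟨(s.equivFin.symm ⟨i, hi⟩ : s), hs (s.equivFin.symm ⟨i, hi⟩).2⟩ else none, fun x => ?_⟩
    constructor
    · intro hx
      refine ⟨⟨s.equivFin ⟨x, hx⟩, (s.equivFin ⟨x, hx⟩).2.trans_le hL⟩, ?_⟩
      simp
    · rintro ⟨i, hi⟩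
      by_cases hc : (i : ℕ) < s.card
      · simp only [hc, dif_pos, Option.map_some, Option.some.injEq] at hi
        exact hi ▸ (s.equivFin.symm ⟨i, hc⟩).2
      · simp [hc] at hi
  choose! f hf using hrep
  refine ⟨fun s => φ (f s), fun s hs s' hs' heq => ?_⟩
  have := φ.injective heq
  ext x
  rw [hf s hs, hf s' hs', this]

namespace CliqueAlgorithm

/-- Schedules in which a message is a small set of items; the empty set is not sent. -/
theorem exists_of_finset_schedule {n w L : ℕ} {𝒢 Input Output Item : Type} (box : Finset Item)
    (hbox : (box.card + 1) ^ L ≤ 2 ^ w)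
    (input : 𝒢 → Fin n → Input) (R : ℕ) (μ : ℕ → 𝒢 → Fin n → Fin n → Finset Item)
    (out : 𝒢 → Fin n → Output)
    (hsub : ∀ t < R, ∀ G u v, μ t G u v ⊆ box) (hcard : ∀ t < R, ∀ G u v, (μ t G u v).card ≤ L)
    (hμ : ∀ t < R, ∀ G G' u, SameView input μ t G G' u → ∀ v, μ t G u v = μ t G' u v)
    (hout : ∀ G G' u, SameView input μ R G G' u → out G u = out G' u) [Nonempty Output] :
    ∃ A : CliqueAlgorithm n w Input Output, A.rounds = R ∧ ∀ G,
      A.messageCount (input G) = ∑ t ∈ range R,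
        (univ.filter fun p : Fin n × Fin n => (μ t G p.1 p.2).Nonempty).card ∧
      ∀ v, A.result (input G) v = out G v := by
  classical
  obtain ⟨code, hcode⟩ := exists_injOn_bitVec box L w hbox
  let ν : ℕ → 𝒢 → Fin n → Fin n → Option (BitVec w) :=
    fun t G u v => if (μ t G u v).Nonempty then some (code (μ t G u v)) else none
  have hinj : ∀ t < R, ∀ G G' u v, ν t G u v = ν t G' u v → μ t G u v = μ t G' u v := by
    intro t ht G G' u v h
    by_cases h1 : (μ t G u v).Nonempty <;> by_cases h2 : (μ t G' u v).Nonempty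
    · simp only [ν, h1, h2, if_true, Option.some.injEq] at h
      exact hcode ⟨hsub t ht _ _ _, hcard t ht _ _ _⟩ ⟨hsub t ht _ _ _, hcard t ht _ _ _⟩ h
    · simp [ν, h1, h2] at h
    · simp [ν, h1, h2] at h
    · rw [Finset.not_nonempty_iff_eq_empty.1 h1, Finset.not_nonempty_iff_eq_empty.1 h2]
  have hview : ∀ t ≤ R, ∀ G G' u, SameView input ν t G G' u → SameView input μ t G G' u :=
    fun t ht G G' u h => ⟨h.1, fun t' ht' v => hinj t' (by omega) G G' v u (h.2 t' ht' v)⟩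
  obtain ⟨A, h1, h2⟩ := exists_of_schedule input R ν out
    (fun t ht G G' u h => by
      funext v
      simp only [ν, hμ t ht G G' u (hview t ht.le G G' u h) v])
    (fun G G' u h => hout G G' u (hview R le_rfl G G' u h))
  refine ⟨A, h1, fun G => ⟨(h2 G).1.trans ?_, (h2 G).2⟩⟩
  refine Finset.sum_congr rfl fun t _ => ?_
  congr 1
  refine Finset.filter_congr fun p _ => ?_
  by_cases h : (μ t G p.1 p.2).Nonempty <;> simp [ν, h]

end CliqueAlgorithm

/-! ### Interval scheduling. -/

/-- Non-preemptive scheduling by first fit in the order of decreasing sizes. -/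
theorem exists_start_times {β : Type*} [DecidableEq β] (size : β → ℕ) (rel : β → β → Prop)
    [DecidableRel rel] (hsymm : ∀ b b', rel b b' → rel b' b) (N : ℕ) (B : Finset β)
    (h : ∀ b ∈ B, 2 * ∑ b' ∈ B.filter (rel b), size b' < N) :
    ∃ t : β → ℕ, (∀ b ∈ B, t b < N) ∧ ∀ b ∈ B, ∀ b' ∈ B, b ≠ b' → rel b b' →
      t b + size b ≤ t b' ∨ t b' + size b' ≤ t b := by
  induction B using Finset.induction_on_min_value size with
  | empty => exact ⟨fun _ => 0, by simp, by simp⟩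
  | insert c B hcB hmin ih =>
    obtain ⟨t, hN, hdisj⟩ := ih fun b hb => lt_of_le_of_lt
      (Nat.mul_le_mul_left 2 (Finset.sum_le_sum_of_subset
        (Finset.filter_subset_filter _ (Finset.subset_insert _ _))))
      (h b (Finset.mem_insert_of_mem hb))
    -- Since `c` is no larger than any placed block `b`, a start time at which it overlaps `b`
    -- differs from `t b` by at most `size b`; so `b` forbids at most `2 * size b` values.
    let bad : Finset ℕ := (B.filter (rel c)).biUnion fun b =>
      Finset.Ico (t b - size b) (t b + size b)
    have hbad : bad.card < N := by
      calc bad.card ≤ ∑ b ∈ B.filter (rel c), (Finset.Ico (t b - size b) (t b + size b)).card :=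
            Finset.card_biUnion_le
        _ ≤ ∑ b ∈ B.filter (rel c), 2 * size b := by
            refine Finset.sum_le_sum fun b _ => ?_
            rw [Nat.card_Ico]
            omega
        _ = 2 * ∑ b ∈ B.filter (rel c), size b := by rw [Finset.mul_sum]
        _ ≤ 2 * ∑ b ∈ (insert c B).filter (rel c), size b :=
            Nat.mul_le_mul_left 2 (Finset.sum_le_sum_of_subset
              (Finset.filter_subset_filter _ (Finset.subset_insert _ _)))
        _ < N := h c (Finset.mem_insert_self _ _)
    obtain ⟨s, hs, hsbad⟩ : ∃ s ∈ Finset.range N, s ∉ bad := by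
      by_contra! hall
      have := Finset.card_le_card (fun s hs => hall s hs : Finset.range N ⊆ bad)
      rw [Finset.card_range] at this
      omega
    have hfree : ∀ b ∈ B, rel c b → s + size c ≤ t b ∨ t b + size b ≤ s := by
      intro b hb hrel
      by_contra! hcon
      refine hsbad (Finset.mem_biUnion.2 ⟨b, Finset.mem_filter.2 ⟨hb, hrel⟩, ?_⟩)
      have := hmin b hb
      rw [Finset.mem_Ico]
      omega
    refine ⟨Function.update t c s, fun b hb => ?_, fun b hb b' hb' hne hrel => ?_⟩
    · rcases eq_or_ne b c with rfl | hbc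
      · simpa using hs
      · rw [Function.update_of_ne hbc]
        exact hN b (Finset.mem_of_mem_insert_of_ne hb hbc)
    · rcases eq_or_ne b c with rfl | hbc
      · have hb'B := Finset.mem_of_mem_insert_of_ne hb' hne.symm
        rw [Function.update_self, Function.update_of_ne hne.symm]
        exact hfree b' hb'B hrel
      · have hbB := Finset.mem_of_mem_insert_of_ne hb hbc
        rcases eq_or_ne b' c with rfl | hbc'
        · rw [Function.update_self, Function.update_of_ne hne]
          exact (hfree b hbB (hsymm _ _ hrel)).symm
        · rw [Function.update_of_ne hbc, Function.update_of_ne hbc']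
          exact hdisj b hbB b' (Finset.mem_of_mem_insert_of_ne hb' hbc') hne hrel

/-! ### Dividing the blocks of a group of vertices among parts -/

section Plan

variable {n : ℕ} (g : ℕ) (d : Fin n → ℕ → ℕ)

/-- The total size of the blocks before block `(u, j)`, in the lexicographic order of `(j, u)`. -/
def blockOffset (u : Fin n) (j : ℕ) : ℕ :=
  ∑ j' ∈ range j, ∑ u', d u' j' + ∑ u' ∈ univ.filter (· < u), d u' j

/-- The part to which block `(u, j)` belongs. -/
def partIndex (u : Fin n) (j : ℕ) : ℕ := j + blockOffset d u j / n

variable {d}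

theorem sum_filter_lt_add_le (u : Fin n) (j : ℕ) :
    ∑ u' ∈ univ.filter (· < u), d u' j + d u j ≤ ∑ u', d u' j := by
  rw [add_comm, ← Finset.sum_insert (s := univ.filter (· < u)) (f := fun u' => d u' j) (by simp)]
  exact Finset.sum_le_sum_of_subset (Finset.subset_univ _)

theorem blockOffset_add_le {u : Fin n} {j j' : ℕ} (h : j < j') :
    blockOffset d u j + d u j ≤ ∑ i ∈ range j', ∑ u', d u' i := by
  have h1 := sum_filter_lt_add_le (d := d) u j
  have h2 : ∑ i ∈ range (j + 1), ∑ u', d u' i ≤ ∑ i ∈ range j', ∑ u', d u' i :=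
    Finset.sum_le_sum_of_subset (Finset.range_subset_range.2 h)
  rw [Finset.sum_range_succ] at h2
  unfold blockOffset
  omega

/-- Offsets are monotone in `j`, and the summand `j` makes the index strictly increasing. Hence no
part mixes two target groups. -/
theorem partIndex_lt_of_lt {u u' : Fin n} {j j' : ℕ} (h : j < j') :
    partIndex d u j < partIndex d u' j' := by
  have h1 := blockOffset_add_le (d := d) (u := u) h
  have h2 : blockOffset d u j / n ≤ blockOffset d u' j' / n := by
    refine Nat.div_le_div_right ?_
    unfold blockOffset at *
    omega
  unfold partIndex
  omega

theorem eq_of_partIndex_eq {u u' : Fin n} {j j' : ℕ} (h : partIndex d u j = partIndex d u' j') :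
    j = j' := by
  rcases lt_trichotomy j j' with hlt | heq | hlt
  · exact absurd h (partIndex_lt_of_lt hlt).ne
  · exact heq
  · exact absurd h (partIndex_lt_of_lt hlt).ne'

variable {g}

theorem partIndex_lt {u : Fin n} {j : ℕ} (hj : j < g) :
    partIndex d u j < g + (∑ i ∈ range g, ∑ u', d u' i) / n := by
  have h1 := blockOffset_add_le (d := d) (u := u) hj
  have h2 : blockOffset d u j / n ≤ (∑ i ∈ range g, ∑ u', d u' i) / n :=
    Nat.div_le_div_right (by omega)
  unfold partIndex
  omega

/-- The offsets of the first and the last block of a part have the same quotient by `n`, so they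
differ by less than `n`; the last block adds at most `n`. -/
theorem sum_part_le (hd : ∀ u, ∀ j < g, d u j ≤ n) {j : ℕ} (hj : j < g) (κ : ℕ) :
    ∑ u ∈ univ.filter (fun u => partIndex d u j = κ), d u j ≤ 2 * n := by
  set U := univ.filter (fun u : Fin n => partIndex d u j = κ) with hU
  rcases U.eq_empty_or_nonempty with h | h
  · simp [h]
  · have ha := (Finset.mem_filter.1 (U.min'_mem h)).2
    have hb := (Finset.mem_filter.1 (U.max'_mem h)).2
    set a := U.min' h
    set b := U.max' h
    have hpos : 0 < n := a.pos
    have hsum : ∑ u ∈ U, d u j + ∑ u ∈ univ.filter (· < a), d u j ≤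
        ∑ u ∈ univ.filter (· < b), d u j + d b j := by
      rw [← Finset.sum_union, add_comm _ (d b j),
        ← Finset.sum_insert (s := univ.filter (· < b)) (f := fun u' => d u' j) (by simp)]
      · refine Finset.sum_le_sum_of_subset fun u hu => ?_
        have hle : u ≤ b := by
          rcases Finset.mem_union.1 hu with hu | hu
          · exact U.le_max' u hu
          · exact ((Finset.mem_filter.1 hu).2.trans_le (U.min'_le_max' h)).le
        rcases hle.eq_or_lt with rfl | hlt
        · exact Finset.mem_insert_self _ _
        · exact Finset.mem_insert_of_mem (Finset.mem_filter.2 ⟨Finset.mem_univ _, hlt⟩)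
      · refine Finset.disjoint_left.2 fun u hu hu' => ?_
        exact absurd (U.min'_le u hu) (not_le.2 (Finset.mem_filter.1 hu').2)
    have hdiv : blockOffset d a j / n = blockOffset d b j / n := by
      unfold partIndex at ha hb
      omega
    have h1 := Nat.div_add_mod (blockOffset d a j) n
    have h2 := Nat.div_add_mod (blockOffset d b j) n
    have h3 := Nat.mod_lt (blockOffset d b j) hpos
    have h4 := hd b j hj
    rw [hdiv] at h1
    unfold blockOffset at h1 h2 h3
    omega

variable (g d) in
/-- The property of start times for the blocks that no two blocks of the same vertex or of the same
part overlap. -/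
def IsPlan (t : Fin n → ℕ → ℕ) : Prop :=
  ∀ u, ∀ j < g, t u j ≤ 6 * n ∧ ∀ u', ∀ j' < g, (u, j) ≠ (u', j') →
    (u = u' ∨ partIndex d u j = partIndex d u' j') →
    t u j + d u j ≤ t u' j' ∨ t u' j' + d u' j' ≤ t u j

/-- A block conflicts with its row, of total size at most `n`, and its part, of total size at most
`2 * n`; first fit needs twice the sum, which gives the start bound `6 * n`. -/
theorem exists_isPlan (hd : ∀ u, ∑ j ∈ range g, d u j ≤ n) : ∃ t, IsPlan g d t := by
  classical
  let rel : Fin n × ℕ → Fin n × ℕ → Prop :=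
    fun b b' => b.1 = b'.1 ∨ partIndex d b.1 b.2 = partIndex d b'.1 b'.2
  have hd' : ∀ u, ∀ j < g, d u j ≤ n := fun u j hj =>
    (Finset.single_le_sum (f := fun j => d u j) (fun _ _ => Nat.zero_le _)
      (Finset.mem_range.2 hj)).trans (hd u)
  obtain ⟨t, h1, h2⟩ := exists_start_times (fun b : Fin n × ℕ => d b.1 b.2) rel
    (fun b b' h => h.imp Eq.symm Eq.symm) (6 * n + 1) (univ ×ˢ range g) (by
      rintro ⟨u, j⟩ hb
      have hj : j < g := by simpa using hb
      have hs1 : ∑ b ∈ (univ ×ˢ range g).filter (fun b : Fin n × ℕ => u = b.1), d b.1 b.2 ≤ n := by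
        refine le_trans (le_of_eq ?_) (hd u)
        refine Finset.sum_bij' (fun b _ => b.2) (fun j _ => (u, j)) ?_ ?_ ?_ ?_ ?_
        · rintro ⟨u', j'⟩ h
          simp at h ⊢
          exact h.1
        · intro j' h
          simpa using h
        · rintro ⟨u', j'⟩ h
          simp at h ⊢
          exact h.2
        · simp
        · rintro ⟨u', j'⟩ h
          simp at h ⊢
          rw [h.2]
      have hs2 : ∑ b ∈ (univ ×ˢ range g).filter
          (fun b : Fin n × ℕ => partIndex d u j = partIndex d b.1 b.2), d b.1 b.2 ≤ 2 * n := by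
        refine le_trans (le_of_eq ?_) (sum_part_le hd' hj (partIndex d u j))
        refine Finset.sum_bij' (fun b _ => b.1) (fun u _ => (u, j)) ?_ ?_ ?_ ?_ ?_
        · rintro ⟨u', j'⟩ h
          simp at h ⊢
          obtain rfl := eq_of_partIndex_eq h.2
          exact h.2.symm
        · intro u' h
          simp at h ⊢
          exact ⟨hj, h.symm⟩
        · rintro ⟨u', j'⟩ h
          simp at h ⊢
          exact eq_of_partIndex_eq h.2
        · simp
        · rintro ⟨u', j'⟩ h
          simp at h ⊢
          rw [eq_of_partIndex_eq h.2]
      have hs3 : ∑ b ∈ (univ ×ˢ range g).filter (rel (u, j)), d b.1 b.2 ≤ n + 2 * n := by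
        rw [show (univ ×ˢ range g).filter (rel (u, j)) =
          (univ ×ˢ range g).filter (fun b : Fin n × ℕ => u = b.1) ∪ (univ ×ˢ range g).filter
          (fun b : Fin n × ℕ => partIndex d u j = partIndex d b.1 b.2) from Finset.filter_or _ _ _]
        refine le_trans ?_ (Nat.add_le_add hs1 hs2)
        rw [← Finset.sum_union_inter]
        exact Nat.le_add_right _ _
      change 2 * ∑ b ∈ (univ ×ˢ range g).filter (rel (u, j)), d b.1 b.2 < _
      omega)
  refine ⟨fun u j => t (u, j), fun u j hj => ⟨?_, fun u' j' hj' hne hrel => ?_⟩⟩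
  · exact Nat.le_of_lt_succ (h1 (u, j) (by simpa using hj))
  · exact h2 (u, j) (by simpa using hj) (u', j') (by simpa using hj') hne hrel

open Classical in
variable (g d) in
/-- Start times for the blocks of a group. -/
noncomputable def startTime : Fin n → ℕ → ℕ :=
  if h : ∃ t, IsPlan g d t then h.choose else fun _ _ => 0

theorem isPlan_startTime (hd : ∀ u, ∑ j ∈ range g, d u j ≤ n) : IsPlan g d (startTime g d) := by
  have h := exists_isPlan hd
  rw [startTime, dif_pos h]
  exact h.choose_spec

end Plan

/-- The link bound for routing modulo `n`: keys with distinct numbers below `L * n` meet at one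
player at most `L` times. -/
theorem Finset.card_le_of_mod_eq {κ : Type*} {n L r : ℕ} (S : Finset κ) (f : κ → ℕ)
    (hf : Set.InjOn f S) (hlt : ∀ k ∈ S, f k < L * n) (hmod : ∀ k ∈ S, f k % n = r) :
    S.card ≤ L := by
  rw [← Finset.card_range L]
  refine Finset.card_le_card_of_injOn (fun k => f k / n) (fun k hk => ?_) fun k hk k' hk' h => ?_
  · simpa using Nat.div_lt_of_lt_mul (mul_comm L n ▸ hlt k hk)
  · refine hf hk hk' ?_
    rw [← Nat.div_add_mod (f k) n, ← Nat.div_add_mod (f k') n, hmod k hk, hmod k' hk']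
    simp only at h
    rw [h]

theorem card_filter_mod_eq_le (n g i : ℕ) :
    (univ.filter fun u : Fin n => (u : ℕ) % g = i).card ≤ n / g + 1 := by
  rw [← Finset.card_range (n / g + 1)]
  refine Finset.card_le_card_of_injOn (fun u => (u : ℕ) / g) (fun u _ => ?_)
    fun u hu u' hu' h => ?_
  · simpa using Nat.lt_succ_of_le (Nat.div_le_div_right u.2.le)
  · have h1 : (u : ℕ) % g = i := by simpa using hu
    have h2 : (u' : ℕ) % g = i := by simpa using hu'
    ext
    simp only at h
    rw [← Nat.div_add_mod (u : ℕ) g, ← Nat.div_add_mod (u' : ℕ) g, h, h1, h2]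

/-! ### The sparsification protocol -/

/-- A message is a set of such tuples. -/
abbrev Item : Type := ℕ × ℕ × ℕ × ℕ × ℤ

section Route

variable {n : ℕ} {κ κ' : Type*}

/-- The items that `x` sends to `y` when every key `k` causes `src k` to send `item k` to
`dst k`. -/
def route (keys : Finset κ) (src dst : κ → Fin n) (item : κ → Item) (x y : Fin n) :
    Finset Item :=
  (keys.filter fun k => src k = x ∧ dst k = y).image item

variable {keys : Finset κ} {src dst dst₂ : κ → Fin n} {item item₂ : κ → Item}
  {keys' : Finset κ} {src' dst' dst₂' : κ → Fin n} {item' item₂' : κ → Item} {x y : Fin n}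

theorem mem_route {a : Item} :
    a ∈ route keys src dst item x y ↔ ∃ k ∈ keys, src k = x ∧ dst k = y ∧ item k = a := by
  simp [route, and_assoc]

/-- For messages whose keys their sender determines itself; forwarded messages are treated by
`route_forward`. -/
theorem route_congr (hk : ∀ k, src k = x → (k ∈ keys ↔ k ∈ keys'))
    (hs : ∀ k, src k = x ↔ src' k = x)
    (hd : ∀ k ∈ keys, src k = x → dst k = dst' k)
    (hi : ∀ k ∈ keys, src k = x → item k = item' k) :
    route keys src dst item x y = route keys' src' dst' item' x y := by
  ext a
  simp only [mem_route]
  constructor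
  · rintro ⟨k, h1, h2, h3, h4⟩
    exact ⟨k, (hk k h2).1 h1, (hs k).1 h2, (hd k h1 h2) ▸ h3, (hi k h1 h2) ▸ h4⟩
  · rintro ⟨k, h1, h2, h3, h4⟩
    have h2' := (hs k).2 h2
    have h1' := (hk k h2').2 h1
    exact ⟨k, h1', h2', (hd k h1' h2').symm ▸ h3, (hi k h1' h2').symm ▸ h4⟩

/-- What a player forwards is determined by what it has received. -/
theorem route_forward (φ : Fin n → Item → Fin n) (ψ : Fin n → Item → Item)
    (hφ : ∀ k ∈ keys, dst₂ k = φ (src k) (item k)) (hψ : ∀ k ∈ keys, item₂ k = ψ (src k) (item k))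
    (hφ' : ∀ k ∈ keys', dst₂' k = φ (src' k) (item' k))
    (hψ' : ∀ k ∈ keys', item₂' k = ψ (src' k) (item' k))
    (h : ∀ x, route keys src dst item x y = route keys' src' dst' item' x y) (z : Fin n) :
    route keys dst dst₂ item₂ y z = route keys' dst' dst₂' item₂' y z := by
  ext a
  have key : ∀ x b, (∃ k ∈ keys, src k = x ∧ dst k = y ∧ item k = b) ↔
      ∃ k ∈ keys', src' k = x ∧ dst' k = y ∧ item' k = b := fun x b => by
    simpa only [mem_route] using (Finset.ext_iff.1 (h x) b)
  simp only [mem_route]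
  constructor
  · rintro ⟨k, h1, h2, h3, h4⟩
    obtain ⟨k', h1', h2', h3', h4'⟩ := (key (src k) (item k)).1 ⟨k, h1, rfl, h2, rfl⟩
    refine ⟨k', h1', h3', ?_, ?_⟩
    · rw [hφ' k' h1', h2', h4', ← hφ k h1, h3]
    · rw [hψ' k' h1', h2', h4', ← hψ k h1, h4]
  · rintro ⟨k, h1, h2, h3, h4⟩
    obtain ⟨k', h1', h2', h3', h4'⟩ := (key (src' k) (item' k)).2 ⟨k, h1, rfl, h2, rfl⟩
    refine ⟨k', h1', h3', ?_, ?_⟩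
    · rw [hφ k' h1', h2', h4', ← hφ' k h1, h3]
    · rw [hψ k' h1', h2', h4', ← hψ' k h1, h4]

theorem card_route_nonempty_le (keys : Finset κ) (src dst : κ → Fin n) (item : κ → Item) :
    (univ.filter fun p : Fin n × Fin n => (route keys src dst item p.1 p.2).Nonempty).card ≤
      keys.card := by
  classical
  refine le_trans (Finset.card_le_card (t := keys.image fun k => (src k, dst k)) ?_)
    Finset.card_image_le
  rintro ⟨x, y⟩ h
  obtain ⟨a, ha⟩ := (Finset.mem_filter.1 h).2
  obtain ⟨k, h1, rfl, rfl, -⟩ := mem_route.1 ha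
  exact Finset.mem_image_of_mem _ h1

theorem card_route_le (keys : Finset κ) (src dst : κ → Fin n) (item : κ → Item) (x y : Fin n) :
    (route keys src dst item x y).card ≤ (keys.filter fun k => src k = x ∧ dst k = y).card :=
  Finset.card_image_le

end Route

/-- The player with number `x` modulo `n`. -/
def wrap {n : ℕ} (u : Fin n) (x : ℕ) : Fin n := ⟨x % n, Nat.mod_lt _ u.pos⟩

section Sparsify

variable {n : ℕ}

theorem exists_sparse_part (S : Finset (Fin n × Fin n × ℤ)) :
    ∃ F ⊆ S, (∀ e ∈ S, (SimpleGraph.fromEdgeSet {x | ∃ f ∈ F, f.2.2 ≤ e.2.2 ∧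
      x = s(f.1, f.2.1)}).Reachable e.1 e.2.1) ∧
      ∀ W : Finset (Fin n), (∀ e ∈ S, e.1 ∈ W ∧ e.2.1 ∈ W) → F.card ≤ W.card :=
  exists_sparse_bottleneck (fun e => e.1) (fun e => e.2.1) (fun e => e.2.2) S

/-- The sparse subset that the holder of a part selects. -/
noncomputable def sparsePart (S : Finset (Fin n × Fin n × ℤ)) : Finset (Fin n × Fin n × ℤ) :=
  (exists_sparse_part S).choose

theorem sparsePart_subset (S : Finset (Fin n × Fin n × ℤ)) : sparsePart S ⊆ S :=
  (exists_sparse_part S).choose_spec.1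

theorem reachable_sparsePart (S : Finset (Fin n × Fin n × ℤ)) {e : Fin n × Fin n × ℤ}
    (he : e ∈ S) : (SimpleGraph.fromEdgeSet {x | ∃ f ∈ sparsePart S, f.2.2 ≤ e.2.2 ∧
      x = s(f.1, f.2.1)}).Reachable e.1 e.2.1 :=
  (exists_sparse_part S).choose_spec.2.1 e he

theorem card_sparsePart_le (S : Finset (Fin n × Fin n × ℤ)) (W : Finset (Fin n))
    (hW : ∀ e ∈ S, e.1 ∈ W ∧ e.2.1 ∈ W) : (sparsePart S).card ≤ W.card :=
  (exists_sparse_part S).choose_spec.2.2 W hW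

end Sparsify

namespace WeightedGraph

open Classical

variable {n : ℕ}

section Groups

variable (g : ℕ) (G : WeightedGraph (Fin n))

/-- The ordered pairs of adjacent vertices. -/
noncomputable def darts : Finset (Fin n × Fin n) := univ.filter fun p => G.graph.Adj p.1 p.2

/-- The number of groups into which the vertices are divided; `0` if the graph is too sparse. -/
noncomputable def numGroups : ℕ := Nat.sqrt (G.darts.card / n)

/-- The darts that are processed. -/
noncomputable def activeDarts : Finset (Fin n × Fin n) := if 0 < g then G.darts else ∅

/-- The pairs of a vertex and a group. -/
def blocks (n g : ℕ) : Finset (Fin n × ℕ) := univ ×ˢ range g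

/-- The number of the neighbours of `u` in group `j`. -/
noncomputable def blockSize (u : Fin n) (j : ℕ) : ℕ :=
  (univ.filter fun v : Fin n => G.graph.Adj u v ∧ (v : ℕ) % g = j).card

/-- The sizes of the blocks of group `i`. -/
noncomputable def groupTable (i : ℕ) (u : Fin n) (j : ℕ) : ℕ :=
  if (u : ℕ) % g = i ∧ j < g then G.blockSize g u j else 0

noncomputable def blockPart (u : Fin n) (j : ℕ) : ℕ := partIndex (G.groupTable g (u % g)) u j

/-- Like the part, this depends only on the table of one group, so the center of that group can
compute it. -/
noncomputable def blockStart (u : Fin n) (j : ℕ) : ℕ := startTime g (G.groupTable g (u % g)) u j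

noncomputable def rank (u v : Fin n) : ℕ :=
  (univ.filter fun v' : Fin n => (G.graph.Adj u v' ∧ (v' : ℕ) % g = v % g) ∧ v' < v).card

noncomputable def dartPart (u v : Fin n) : ℕ := G.blockPart g u (v % g)

/-- The start is planned by the center, while the rank inside the block is known to `u` alone. -/
noncomputable def slot (u v : Fin n) : ℕ := G.blockStart g u (v % g) + G.rank g u v

/-- The position of block `(u, j)` in the table of the group of `u`. -/
def tableIndex (u : Fin n) (j : ℕ) : ℕ := (u : ℕ) / g * g + j

/-- The number of a part among all parts of all groups. -/
def globalPart (u : Fin n) (κ : ℕ) : ℕ := (u : ℕ) % g * (g + n / g + 1) + κ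

/-- A vertex has `g` sizes for one center, too many for one link; relays spread them. -/
def relay (u : Fin n) (j : ℕ) : Fin n := wrap u (tableIndex g u j)

def center (u : Fin n) : Fin n := wrap u (u % g)

noncomputable def middle (u v : Fin n) : Fin n := wrap u (G.slot g u v)

def holder (u : Fin n) (κ : ℕ) : Fin n := wrap u (globalPart g u κ)

/-- The weighted darts in part `κ` of group `i`. -/
noncomputable def partDarts (i κ : ℕ) : Finset (Fin n × Fin n × ℤ) :=
  ((G.activeDarts g).filter fun p => (p.1 : ℕ) % g = i ∧ G.dartPart g p.1 p.2 = κ).image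
    fun p => (p.1, p.2, G.weight s(p.1, p.2))

/-- The darts that are selected by the holders of their parts. -/
noncomputable def keptDarts : Finset (Fin n × Fin n) :=
  (G.activeDarts g).filter fun p => (p.1, p.2, G.weight s(p.1, p.2)) ∈
    sparsePart (G.partDarts g (p.1 % g) (G.dartPart g p.1 p.2))

end Groups

section Protocol

variable (G : WeightedGraph (Fin n))

noncomputable def deg (u : Fin n) : ℕ := (univ.filter fun v => G.graph.Adj u v).card

noncomputable def degreeMessage (u v : Fin n) : Finset Item :=
  if (v : ℕ) = 0 ∧ 0 < G.deg u then {(G.deg u, 0, 0, 0, 0)} else ∅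

/-- The broadcast costs `n` messages and takes place only if `n` is at most the number of darts;
silence stands for `0`. -/
noncomputable def groupsMessage (u _v : Fin n) : Finset Item :=
  if (u : ℕ) = 0 ∧ 0 < G.numGroups then {(G.numGroups, 0, 0, 0, 0)} else ∅

noncomputable def sizeToRelay (g : ℕ) : Fin n → Fin n → Finset Item :=
  route (blocks n g) (fun b => b.1) (fun b => relay g b.1 b.2)
    (fun b => (b.2, G.blockSize g b.1 b.2, 0, 0, 0))

noncomputable def sizeToCenter (g : ℕ) : Fin n → Fin n → Finset Item :=
  route (blocks n g) (fun b => relay g b.1 b.2) (fun b => center g b.1)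
    (fun b => (b.1, b.2, G.blockSize g b.1 b.2, 0, 0))

noncomputable def planToRelay (g : ℕ) : Fin n → Fin n → Finset Item :=
  route (blocks n g) (fun b => center g b.1) (fun b => relay g b.1 b.2)
    (fun b => (b.1, b.2, G.blockPart g b.1 b.2, G.blockStart g b.1 b.2, 0))

noncomputable def planToVertex (g : ℕ) : Fin n → Fin n → Finset Item :=
  route (blocks n g) (fun b => relay g b.1 b.2) (fun b => b.1)
    (fun b => (b.2, G.blockPart g b.1 b.2, G.blockStart g b.1 b.2, 0, 0))

noncomputable def dartToMiddle (g : ℕ) : Fin n → Fin n → Finset Item :=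
  route (G.activeDarts g) (fun p => p.1) (fun p => G.middle g p.1 p.2)
    (fun p => (p.2, G.dartPart g p.1 p.2, 0, 0, G.weight s(p.1, p.2)))

noncomputable def dartToHolder (g : ℕ) : Fin n → Fin n → Finset Item :=
  route (G.activeDarts g) (fun p => G.middle g p.1 p.2)
    (fun p => holder g p.1 (G.dartPart g p.1 p.2))
    (fun p => (p.1, p.2, G.dartPart g p.1 p.2, 0, G.weight s(p.1, p.2)))

noncomputable def keptToMiddle (g : ℕ) : Fin n → Fin n → Finset Item :=
  route (G.keptDarts g) (fun p => holder g p.1 (G.dartPart g p.1 p.2))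
    (fun p => G.middle g p.1 p.2) (fun p => (p.1, p.2, 0, 0, 0))

noncomputable def keptToSource (g : ℕ) : Fin n → Fin n → Finset Item :=
  route (G.keptDarts g) (fun p => G.middle g p.1 p.2) (fun p => p.1) (fun p => (p.2, 0, 0, 0, 0))

/-- Only one of the two darts of an edge may be selected, so the other end must be told. Sender and
receiver already name the edge, so the content is void. -/
noncomputable def keptToTarget (g : ℕ) : Fin n → Fin n → Finset Item :=
  route (G.keptDarts g) (fun p => p.1) (fun p => p.2) (fun _ => (0, 0, 0, 0, 0))

/-- The messages of all rounds. -/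
noncomputable def protocol : ℕ → WeightedGraph (Fin n) → Fin n → Fin n → Finset Item
  | 0, G => G.degreeMessage
  | 1, G => G.groupsMessage
  | 2, G => G.sizeToRelay G.numGroups
  | 3, G => G.sizeToCenter G.numGroups
  | 4, G => G.planToRelay G.numGroups
  | 5, G => G.planToVertex G.numGroups
  | 6, G => G.dartToMiddle G.numGroups
  | 7, G => G.dartToHolder G.numGroups
  | 8, G => G.keptToMiddle G.numGroups
  | 9, G => G.keptToSource G.numGroups
  | 10, G => G.keptToTarget G.numGroups
  | _, _ => fun _ _ => ∅

/-- The sparse subgraph that the protocol computes. -/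
noncomputable def sparseGraph : SimpleGraph (Fin n) where
  Adj u v := G.graph.Adj u v ∧
    (G.numGroups = 0 ∨ (u, v) ∈ G.keptDarts G.numGroups ∨ (v, u) ∈ G.keptDarts G.numGroups)
  symm := ⟨fun _ _ h => ⟨h.1.symm, h.2.imp_right Or.symm⟩⟩
  loopless := ⟨fun _ h => h.1.ne rfl⟩

noncomputable def sparseInstance : HostedInstance n where
  size := n
  inst := ⟨G.sparseGraph, G.weight⟩
  host := id
  origin := some

end Protocol

end WeightedGraph

/-! ### Every message depends only on what its sender knows -/

namespace WeightedGraph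

open Classical CliqueAlgorithm

variable {n : ℕ} {G G' : WeightedGraph (Fin n)} {u : Fin n}

theorem adj_iff_of_localInput_eq (h : G.localInput u = G'.localInput u) (v : Fin n) :
    G.graph.Adj u v ↔ G'.graph.Adj u v := by
  have := congrFun h v
  unfold localInput at this
  by_cases h1 : G.graph.Adj u v <;> by_cases h2 : G'.graph.Adj u v <;> simp_all

theorem weight_eq_of_localInput_eq (h : G.localInput u = G'.localInput u) {v : Fin n}
    (hv : G.graph.Adj u v) : G.weight s(u, v) = G'.weight s(u, v) := by
  have h2 := (adj_iff_of_localInput_eq h v).1 hv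
  have := congrFun h v
  unfold localInput at this
  simpa [hv, h2] using this

theorem deg_eq_of_localInput_eq (h : G.localInput u = G'.localInput u) : G.deg u = G'.deg u := by
  unfold deg
  congr 1
  exact Finset.filter_congr fun v _ => adj_iff_of_localInput_eq h v

theorem blockSize_eq_of_localInput_eq (h : G.localInput u = G'.localInput u) (g j : ℕ) :
    G.blockSize g u j = G'.blockSize g u j := by
  unfold blockSize
  congr 1
  exact Finset.filter_congr fun v _ => and_congr_left fun _ => adj_iff_of_localInput_eq h v

theorem rank_eq_of_localInput_eq (h : G.localInput u = G'.localInput u) (g : ℕ) (v : Fin n) :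
    G.rank g u v = G'.rank g u v := by
  unfold rank
  congr 1
  exact Finset.filter_congr fun v _ => and_congr_left fun _ => and_congr_left fun _ =>
    adj_iff_of_localInput_eq h v

theorem mem_darts {p : Fin n × Fin n} : p ∈ G.darts ↔ G.graph.Adj p.1 p.2 := by
  simp [darts]

theorem mem_activeDarts {g : ℕ} {p : Fin n × Fin n} :
    p ∈ G.activeDarts g ↔ G.graph.Adj p.1 p.2 ∧ 0 < g := by
  unfold activeDarts
  split_ifs with h <;> simp [mem_darts, h]

theorem card_darts_eq_sum_deg : G.darts.card = ∑ u, G.deg u := by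
  unfold darts deg
  rw [← Finset.univ_product_univ, Finset.card_filter, Finset.sum_product]
  exact Finset.sum_congr rfl fun u _ => (Finset.card_filter _ _).symm

theorem mem_blocks {g : ℕ} {b : Fin n × ℕ} : b ∈ blocks n g ↔ b.2 < g := by
  simp [blocks]

/-- What player `u` has seen in the first `t` rounds is the same for `G` and for `G'`. -/
abbrev View (t : ℕ) (G G' : WeightedGraph (Fin n)) (u : Fin n) : Prop :=
  SameView (fun G : WeightedGraph (Fin n) => G.localInput) protocol t G G' u

/-- Player `0` knows every degree, silence meaning degree `0`, and hence the number of darts. -/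
theorem numGroups_eq_of_view_one (h : View 1 G G' u) (hu : (u : ℕ) = 0) :
    G.numGroups = G'.numGroups := by
  have hdeg : ∀ v, G.deg v = G'.deg v := by
    intro v
    have hv : G.degreeMessage v u = G'.degreeMessage v u := h.2 0 one_pos v
    unfold degreeMessage at hv
    by_cases h1 : 0 < G.deg v <;> by_cases h2 : 0 < G'.deg v
    · simpa [h1, h2, hu] using hv
    · simp [h1, h2, hu] at hv
    · simp [h1, h2, hu] at hv
    · omega
  unfold numGroups
  rw [card_darts_eq_sum_deg, card_darts_eq_sum_deg]
  simp only [hdeg]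

theorem numGroups_eq_of_view (h : View 2 G G' u) : G.numGroups = G'.numGroups := by
  have hv : G.groupsMessage ⟨0, u.pos⟩ u = G'.groupsMessage ⟨0, u.pos⟩ u := h.2 1 one_lt_two _
  unfold groupsMessage at hv
  by_cases h1 : 0 < G.numGroups <;> by_cases h2 : 0 < G'.numGroups
  · simpa [h1, h2] using hv
  · simp [h1, h2] at hv
  · simp [h1, h2] at hv
  · omega

theorem sizeToRelay_local (h : View 2 G G' u) (v : Fin n) :
    G.sizeToRelay G.numGroups u v = G'.sizeToRelay G'.numGroups u v := by
  rw [← numGroups_eq_of_view h]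
  refine route_congr (fun _ _ => Iff.rfl) (fun _ => Iff.rfl) (fun _ _ _ => rfl) ?_
  rintro ⟨u', j⟩ _ rfl
  rw [blockSize_eq_of_localInput_eq h.1]

theorem sizeToCenter_local (h : View 3 G G' u) (v : Fin n) :
    G.sizeToCenter G.numGroups u v = G'.sizeToCenter G'.numGroups u v := by
  have hg := numGroups_eq_of_view (h.mono (by norm_num))
  have hr : ∀ x, G.sizeToRelay G.numGroups x u = G'.sizeToRelay G'.numGroups x u :=
    h.2 2 (by norm_num)
  unfold sizeToCenter
  rw [← hg] at hr ⊢
  exact route_forward (fun x _ => center G.numGroups x) (fun x a => (x, a.1, a.2.1, 0, 0))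
    (fun _ _ => rfl) (fun _ _ => rfl) (fun _ _ => rfl) (fun _ _ => rfl) hr v

theorem center_eq_iff {g : ℕ} (x y : Fin n) :
    center g x = center g y ↔ (x : ℕ) % g = y % g := by
  have h : ∀ z : Fin n, (z : ℕ) % g % n = z % g := fun z =>
    Nat.mod_eq_of_lt ((Nat.mod_le _ _).trans_lt z.2)
  simp [center, wrap, h]

/-- The center has received the size of every block of its group; all other entries are zero by
definition. -/
theorem groupTable_eq (h : View 4 G G' u) {x : Fin n} (hx : center G.numGroups x = u) :
    G.groupTable G.numGroups (x % G.numGroups) =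
      G'.groupTable G'.numGroups (x % G'.numGroups) := by
  have hg : G.numGroups = G'.numGroups := numGroups_eq_of_view (h.mono (by norm_num))
  have hr : ∀ x, G.sizeToCenter G.numGroups x u = G'.sizeToCenter G'.numGroups x u :=
    h.2 3 (by norm_num)
  rw [← hg] at hr ⊢
  funext y j
  unfold groupTable
  split_ifs with hyj
  · have hyu : center G.numGroups y = u := by
      rw [← hx, center_eq_iff]
      exact hyj.1
    have hmem : ((y : ℕ), j, G.blockSize G.numGroups y j, 0, 0) ∈
        G.sizeToCenter G.numGroups (relay G.numGroups y j) u :=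
      mem_route.2 ⟨(y, j), mem_blocks.2 hyj.2, rfl, hyu, rfl⟩
    rw [hr] at hmem
    obtain ⟨⟨y', j'⟩, -, -, -, heq⟩ := mem_route.1 hmem
    simp only [Prod.mk.injEq, Fin.val_inj] at heq
    obtain ⟨rfl, rfl, h3, -, -⟩ := heq
    exact h3.symm
  · rfl

theorem planToRelay_local (h : View 4 G G' u) (v : Fin n) :
    G.planToRelay G.numGroups u v = G'.planToRelay G'.numGroups u v := by
  have hg := numGroups_eq_of_view (h.mono (by norm_num))
  have ht := fun x => groupTable_eq (x := x) h
  rw [← hg] at ht ⊢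
  refine route_congr (fun _ _ => Iff.rfl) (fun _ => Iff.rfl) (fun _ _ _ => rfl) ?_
  intro b _ hb
  simp only [blockPart, blockStart, ht b.1 hb]

theorem planToVertex_local (h : View 5 G G' u) (v : Fin n) :
    G.planToVertex G.numGroups u v = G'.planToVertex G'.numGroups u v := by
  have hg := numGroups_eq_of_view (h.mono (by norm_num))
  have hr : ∀ x, G.planToRelay G.numGroups x u = G'.planToRelay G'.numGroups x u :=
    h.2 4 (by norm_num)
  unfold planToVertex
  rw [← hg] at hr ⊢
  refine route_forward (fun x a => wrap x a.1) (fun x a => (a.2.1, a.2.2.1, a.2.2.2.1, 0, 0))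
    ?_ (fun _ _ => rfl) ?_ (fun _ _ => rfl) hr v
  · intro b _
    ext
    simp [wrap, Nat.mod_eq_of_lt]
  · intro b _
    ext
    simp [wrap, Nat.mod_eq_of_lt]

theorem block_plan_eq (h : View 6 G G' u) {j : ℕ} (hj : j < G.numGroups) :
    G.blockPart G.numGroups u j = G'.blockPart G.numGroups u j ∧
      G.blockStart G.numGroups u j = G'.blockStart G.numGroups u j := by
  have hg := numGroups_eq_of_view (h.mono (by norm_num))
  have hr : ∀ x, G.planToVertex G.numGroups x u = G'.planToVertex G'.numGroups x u :=
    h.2 5 (by norm_num)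
  rw [← hg] at hr
  have hmem : (j, G.blockPart G.numGroups u j, G.blockStart G.numGroups u j, 0, 0) ∈
      G.planToVertex G.numGroups (relay G.numGroups u j) u :=
    mem_route.2 ⟨(u, j), mem_blocks.2 hj, rfl, rfl, rfl⟩
  rw [hr] at hmem
  obtain ⟨⟨y, j'⟩, -, -, hy, heq⟩ := mem_route.1 hmem
  simp only [Prod.mk.injEq] at heq hy
  obtain ⟨rfl, h2, h3, -⟩ := heq
  subst hy
  exact ⟨h2.symm, h3.symm⟩

theorem dartToMiddle_local (h : View 6 G G' u) (v : Fin n) :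
    G.dartToMiddle G.numGroups u v = G'.dartToMiddle G'.numGroups u v := by
  have hg := numGroups_eq_of_view (h.mono (by norm_num))
  rw [← hg]
  refine route_congr ?_ (fun _ => Iff.rfl) ?_ ?_
  · rintro ⟨x, y⟩ rfl
    rw [mem_activeDarts, mem_activeDarts, adj_iff_of_localInput_eq h.1]
  · rintro ⟨x, y⟩ hp rfl
    have hp := mem_activeDarts.1 hp
    simp only [middle, slot, (block_plan_eq h (Nat.mod_lt _ hp.2)).2,
      rank_eq_of_localInput_eq h.1]
  · rintro ⟨x, y⟩ hp rfl
    have hp := mem_activeDarts.1 hp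
    simp only [dartPart, (block_plan_eq h (Nat.mod_lt _ hp.2)).1,
      weight_eq_of_localInput_eq h.1 hp.1]

theorem dartToHolder_local (h : View 7 G G' u) (v : Fin n) :
    G.dartToHolder G.numGroups u v = G'.dartToHolder G'.numGroups u v := by
  have hg := numGroups_eq_of_view (h.mono (by norm_num))
  have hr : ∀ x, G.dartToMiddle G.numGroups x u = G'.dartToMiddle G'.numGroups x u :=
    h.2 6 (by norm_num)
  unfold dartToHolder
  rw [← hg] at hr ⊢
  exact route_forward (fun x a => holder G.numGroups x a.2.1)
    (fun x a => (x, a.1, a.2.1, 0, a.2.2.2.2))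
    (fun _ _ => rfl) (fun _ _ => rfl) (fun _ _ => rfl) (fun _ _ => rfl) hr v

/-- The item carries the ends, part and weight of the dart, and the sender is its middle player, so
the holder also knows the way back. -/
theorem dart_at_holder {g : ℕ} (hr : ∀ x, G.dartToHolder g x u = G'.dartToHolder g x u)
    {p : Fin n × Fin n} (hp : p ∈ G.activeDarts g)
    (hu : holder g p.1 (G.dartPart g p.1 p.2) = u) :
    p ∈ G'.activeDarts g ∧ G'.dartPart g p.1 p.2 = G.dartPart g p.1 p.2 ∧
      G'.weight s(p.1, p.2) = G.weight s(p.1, p.2) ∧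
      G'.middle g p.1 p.2 = G.middle g p.1 p.2 := by
  have hmem : ((p.1 : ℕ), (p.2 : ℕ), G.dartPart g p.1 p.2, 0, G.weight s(p.1, p.2)) ∈
      G.dartToHolder g (G.middle g p.1 p.2) u := mem_route.2 ⟨p, hp, rfl, hu, rfl⟩
  rw [hr] at hmem
  obtain ⟨⟨x, y⟩, h1, h2, -, heq⟩ := mem_route.1 hmem
  simp only [Prod.mk.injEq, Fin.val_inj] at heq
  obtain ⟨rfl, rfl, h3, -, h4⟩ := heq
  exact ⟨h1, h3, h4, h2⟩

theorem mem_partDarts {g i κ : ℕ} {e : Fin n × Fin n × ℤ} :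
    e ∈ G.partDarts g i κ ↔ (e.1, e.2.1) ∈ G.activeDarts g ∧ (e.1 : ℕ) % g = i ∧
      G.dartPart g e.1 e.2.1 = κ ∧ G.weight s(e.1, e.2.1) = e.2.2 := by
  obtain ⟨x, y, w⟩ := e
  simp only [partDarts, Finset.mem_image, Finset.mem_filter, Prod.mk.injEq, Prod.exists]
  constructor
  · rintro ⟨a, b, ⟨h1, h2, h3⟩, rfl, rfl, h4⟩
    exact ⟨h1, h2, h3, h4⟩
  · rintro ⟨h1, h2, h3, h4⟩
    exact ⟨x, y, ⟨h1, h2, h3⟩, rfl, rfl, h4⟩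

theorem holder_congr {g : ℕ} {x y : Fin n} (h : (x : ℕ) % g = y % g) (κ : ℕ) :
    holder g x κ = holder g y κ := by
  ext
  simp [holder, wrap, globalPart, h]

theorem partDarts_subset_of_holder {g : ℕ}
    (hr : ∀ x, G.dartToHolder g x u = G'.dartToHolder g x u) {x : Fin n} {κ : ℕ}
    (hx : holder g x κ = u) : G.partDarts g (x % g) κ ⊆ G'.partDarts g (x % g) κ := by
  intro e he
  rw [mem_partDarts] at he ⊢
  obtain ⟨h1, h2, h3, h4⟩ := he
  obtain ⟨h5, h6, h7, -⟩ := dart_at_holder hr (p := (e.1, e.2.1)) h1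
    (by rw [h3, holder_congr h2, hx])
  exact ⟨h5, h2, h6.trans h3, h7.trans h4⟩

/-- The holder sees the same part for both graphs, and `sparsePart` is a fixed function of that set.
-/
theorem kept_at_holder {g : ℕ} (hr : ∀ x, G.dartToHolder g x u = G'.dartToHolder g x u)
    {p : Fin n × Fin n} (hp : p ∈ G.keptDarts g)
    (hu : holder g p.1 (G.dartPart g p.1 p.2) = u) : p ∈ G'.keptDarts g := by
  unfold keptDarts at hp ⊢
  rw [Finset.mem_filter] at hp ⊢
  obtain ⟨h1, h2, h3, h4⟩ := dart_at_holder hr hp.1 hu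
  refine ⟨h1, ?_⟩
  rw [h2, h3, (partDarts_subset_of_holder (fun x => (hr x).symm) hu).antisymm
    (partDarts_subset_of_holder hr hu)]
  exact hp.2

theorem keptDarts_subset (g : ℕ) : G.keptDarts g ⊆ G.activeDarts g := Finset.filter_subset _ _

theorem keptToMiddle_local (h : View 8 G G' u) (v : Fin n) :
    G.keptToMiddle G.numGroups u v = G'.keptToMiddle G'.numGroups u v := by
  have hg := numGroups_eq_of_view (h.mono (by norm_num))
  have hr : ∀ x, G.dartToHolder G.numGroups x u = G'.dartToHolder G'.numGroups x u :=
    h.2 7 (by norm_num)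
  rw [← hg] at hr ⊢
  have key : ∀ {G₁ G₂ : WeightedGraph (Fin n)} {g : ℕ},
      (∀ x, G₁.dartToHolder g x u = G₂.dartToHolder g x u) →
      G₁.keptToMiddle g u v ⊆ G₂.keptToMiddle g u v := by
    intro G₁ G₂ g hr a ha
    obtain ⟨p, h1, h2, h3, h4⟩ := mem_route.1 ha
    obtain ⟨-, h5, -, h6⟩ := dart_at_holder hr (keptDarts_subset _ h1) h2
    exact mem_route.2 ⟨p, kept_at_holder hr h1 h2, by rw [h5, h2], h6.trans h3, h4⟩
  exact (key hr).antisymm (key fun x => (hr x).symm)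

theorem wrap_val (x y : Fin n) : wrap x y = y := by
  ext
  simp [wrap, Nat.mod_eq_of_lt]

theorem keptToSource_local (h : View 9 G G' u) (v : Fin n) :
    G.keptToSource G.numGroups u v = G'.keptToSource G'.numGroups u v := by
  have hg := numGroups_eq_of_view (h.mono (by norm_num))
  have hr : ∀ x, G.keptToMiddle G.numGroups x u = G'.keptToMiddle G'.numGroups x u :=
    h.2 8 (by norm_num)
  unfold keptToSource
  rw [← hg] at hr ⊢
  exact route_forward (fun x a => wrap x a.1) (fun x a => (a.2.1, 0, 0, 0, 0))
    (fun _ _ => (wrap_val _ _).symm) (fun _ _ => rfl) (fun _ _ => (wrap_val _ _).symm)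
    (fun _ _ => rfl) hr v

theorem keptToTarget_local (h : View 10 G G' u) (v : Fin n) :
    G.keptToTarget G.numGroups u v = G'.keptToTarget G'.numGroups u v := by
  have hg := numGroups_eq_of_view (h.mono (by norm_num))
  have hr : ∀ x, G.keptToSource G.numGroups x u = G'.keptToSource G'.numGroups x u :=
    h.2 9 (by norm_num)
  unfold keptToTarget
  rw [← hg] at hr ⊢
  exact route_forward (fun x a => wrap x a.1) (fun x a => (0, 0, 0, 0, 0))
    (fun _ _ => (wrap_val _ _).symm) (fun _ _ => rfl) (fun _ _ => (wrap_val _ _).symm)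
    (fun _ _ => rfl) hr v

theorem degreeMessage_local (h : View 0 G G' u) (v : Fin n) :
    G.degreeMessage u v = G'.degreeMessage u v := by
  simp only [degreeMessage, deg_eq_of_localInput_eq h.1]

theorem groupsMessage_local (h : View 1 G G' u) (v : Fin n) :
    G.groupsMessage u v = G'.groupsMessage u v := by
  unfold groupsMessage
  by_cases hu : (u : ℕ) = 0
  · rw [numGroups_eq_of_view_one h hu]
  · simp [hu]

theorem protocol_local {t : ℕ} (ht : t < 11) (h : View t G G' u) (v : Fin n) :
    protocol t G u v = protocol t G' u v := by
  interval_cases t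
  · exact degreeMessage_local h v
  · exact groupsMessage_local h v
  · exact sizeToRelay_local h v
  · exact sizeToCenter_local h v
  · exact planToRelay_local h v
  · exact planToVertex_local h v
  · exact dartToMiddle_local h v
  · exact dartToHolder_local h v
  · exact keptToMiddle_local h v
  · exact keptToSource_local h v
  · exact keptToTarget_local h v

theorem mem_keptDarts_iff_left (h : View 11 G G' u) (v : Fin n) :
    (u, v) ∈ G.keptDarts G.numGroups ↔ (u, v) ∈ G'.keptDarts G'.numGroups := by
  have hr : ∀ x, G.keptToSource G.numGroups x u = G'.keptToSource G'.numGroups x u :=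
    h.2 9 (by norm_num)
  have key : ∀ {G₁ G₂ : WeightedGraph (Fin n)},
      (∀ x, G₁.keptToSource G₁.numGroups x u = G₂.keptToSource G₂.numGroups x u) →
      (u, v) ∈ G₁.keptDarts G₁.numGroups → (u, v) ∈ G₂.keptDarts G₂.numGroups := by
    intro G₁ G₂ hr hmem
    have h1 : ((v : ℕ), 0, 0, 0, 0) ∈
        G₁.keptToSource G₁.numGroups (G₁.middle G₁.numGroups u v) u :=
      mem_route.2 ⟨(u, v), hmem, rfl, rfl, rfl⟩
    rw [hr] at h1
    obtain ⟨⟨x, y⟩, h2, -, h3, h4⟩ := mem_route.1 h1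
    simp only [Prod.mk.injEq, Fin.val_inj, and_true] at h3 h4
    rwa [h3, h4] at h2
  exact ⟨key hr, key fun x => (hr x).symm⟩

theorem mem_keptDarts_iff_right (h : View 11 G G' u) (v : Fin n) :
    (v, u) ∈ G.keptDarts G.numGroups ↔ (v, u) ∈ G'.keptDarts G'.numGroups := by
  have hr : G.keptToTarget G.numGroups v u = G'.keptToTarget G'.numGroups v u :=
    h.2 10 (by norm_num) v
  have key : ∀ {G₁ : WeightedGraph (Fin n)}, (v, u) ∈ G₁.keptDarts G₁.numGroups ↔
      (0, 0, 0, 0, 0) ∈ G₁.keptToTarget G₁.numGroups v u := by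
    intro G₁
    constructor
    · exact fun hmem => mem_route.2 ⟨(v, u), hmem, rfl, rfl, rfl⟩
    · intro hmem
      obtain ⟨⟨x, y⟩, h1, h2, h3, -⟩ := mem_route.1 hmem
      simp only at h2 h3
      rwa [h2, h3] at h1
  rw [key, key, hr]

theorem sparseGraph_adj_iff (h : View 11 G G' u) (v : Fin n) :
    G.sparseGraph.Adj u v ↔ G'.sparseGraph.Adj u v := by
  unfold sparseGraph
  simp only
  rw [adj_iff_of_localInput_eq h.1 v, mem_keptDarts_iff_left h, mem_keptDarts_iff_right h,
    numGroups_eq_of_view (h.mono (by norm_num))]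

theorem localView_local (h : View 11 G G' u) :
    G.sparseInstance.localView u = G'.sparseInstance.localView u := by
  have key : ∀ {G₁ G₂ : WeightedGraph (Fin n)}, View 11 G₁ G₂ u →
      (G₁.sparseInstance.localView u).edges ⊆ (G₂.sparseInstance.localView u).edges := by
    rintro G₁ G₂ h r ⟨a, b, hab, ha, rfl⟩
    obtain rfl : a = u := ha
    refine ⟨a, b, (sparseGraph_adj_iff h b).1 hab, rfl, ?_⟩
    have hw : G₁.weight s(a, b) = G₂.weight s(a, b) := weight_eq_of_localInput_eq h.1 hab.1
    change EdgeRecord.mk _ _ _ (G₁.weight s(a, b)) _ = EdgeRecord.mk _ _ _ (G₂.weight s(a, b)) _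
    rw [hw]
    rfl
  have hsymm : View 11 G' G u := ⟨h.1.symm, fun t ht v => (h.2 t ht v).symm⟩
  have hedges := (key h).antisymm (key hsymm)
  have hvert : (G.sparseInstance.localView u).vertices = (G'.sparseInstance.localView u).vertices :=
    rfl
  generalize G.sparseInstance.localView u = X at *
  generalize G'.sparseInstance.localView u = Y at *
  cases X
  cases Y
  simp_all

end WeightedGraph

/-! ### Sizes -/

namespace WeightedGraph

open Classical CliqueAlgorithm

variable {n : ℕ} (G : WeightedGraph (Fin n)) {g : ℕ}

theorem card_darts_eq_two_mul : G.darts.card = 2 * G.numEdges := by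
  have h1 := G.graph.sum_degrees_eq_twice_card_edges
  rw [card_darts_eq_sum_deg, numEdges, Set.ncard_eq_toFinset_card', ← SimpleGraph.edgeFinset, ← h1]
  refine Finset.sum_congr rfl fun u _ => ?_
  rw [deg, ← SimpleGraph.card_neighborFinset_eq_degree, SimpleGraph.neighborFinset_eq_filter]

theorem deg_le (u : Fin n) : G.deg u ≤ n :=
  (Finset.card_le_univ _).trans_eq (Fintype.card_fin n)

theorem card_darts_le : G.darts.card ≤ n * n := by
  rw [card_darts_eq_sum_deg]
  exact (Finset.sum_le_card_nsmul _ _ n fun u _ => G.deg_le u).trans (by simp)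

theorem numGroups_sq_mul_le : G.numGroups * G.numGroups * n ≤ G.darts.card :=
  (Nat.mul_le_mul_right n (Nat.sqrt_le _)).trans (Nat.div_mul_le_self _ _)

theorem numGroups_sq_le : G.numGroups * G.numGroups ≤ n :=
  (Nat.sqrt_le _).trans (Nat.div_le_of_le_mul G.card_darts_le)

theorem card_activeDarts_le : (G.activeDarts g).card ≤ G.darts.card := by
  unfold activeDarts
  split_ifs <;> simp

theorem card_keptDarts_le_darts : (G.keptDarts g).card ≤ G.darts.card :=
  (Finset.card_le_card (keptDarts_subset g)).trans G.card_activeDarts_le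

/-- The choice of `numGroups` gives $gn \le g^2 n \le M$, so messages about blocks are charged to
edges. -/
theorem card_blocks_le : (blocks n G.numGroups).card ≤ G.darts.card := by
  refine le_trans ?_ G.numGroups_sq_mul_le
  rw [blocks, Finset.card_product, Finset.card_univ, Fintype.card_fin, Finset.card_range, mul_comm]
  exact Nat.mul_le_mul_right _ (Nat.le_mul_self _)

theorem card_degreeMessage_le :
    (univ.filter fun p : Fin n × Fin n => (G.degreeMessage p.1 p.2).Nonempty).card ≤
      G.darts.card := by
  have h : (univ.filter fun u => 0 < G.deg u).card ≤ G.darts.card := by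
    rw [card_darts_eq_sum_deg, Finset.card_eq_sum_ones]
    refine (Finset.sum_le_sum fun u hu => ?_).trans
      (Finset.sum_le_sum_of_subset (f := G.deg) (Finset.filter_subset _ _))
    exact (Finset.mem_filter.1 hu).2
  refine le_trans (Finset.card_le_card_of_injOn Prod.fst ?_ ?_) h
  · intro p hp
    have := (Finset.mem_filter.1 hp).2
    unfold degreeMessage at this
    split_ifs at this with hc
    · simpa using hc.2
    · simp at this
  · have h0 : ∀ p ∈ univ.filter (fun p : Fin n × Fin n => (G.degreeMessage p.1 p.2).Nonempty),
        (p.2 : ℕ) = 0 := by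
      intro p hp
      have := (Finset.mem_filter.1 hp).2
      unfold degreeMessage at this
      split_ifs at this with hc
      · exact hc.1
      · simp at this
    intro p hp q hq hpq
    exact Prod.ext hpq (Fin.ext ((h0 p hp).trans (h0 q hq).symm))

theorem card_groupsMessage_le :
    (univ.filter fun p : Fin n × Fin n => (G.groupsMessage p.1 p.2).Nonempty).card ≤
      G.darts.card := by
  have h0 : ∀ p ∈ univ.filter (fun p : Fin n × Fin n => (G.groupsMessage p.1 p.2).Nonempty),
      (p.1 : ℕ) = 0 ∧ 0 < G.numGroups := by
    intro p hp
    have := (Finset.mem_filter.1 hp).2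
    unfold groupsMessage at this
    split_ifs at this with hc
    · exact hc
    · simp at this
  rcases Nat.eq_zero_or_pos G.numGroups with hg | hg
  · rw [Finset.card_eq_zero.2]
    · exact Nat.zero_le _
    · refine Finset.eq_empty_of_forall_notMem fun p hp => ?_
      have := (h0 p hp).2
      omega
  · have hn : n ≤ G.darts.card :=
      (Nat.le_mul_of_pos_left n (Nat.mul_pos hg hg)).trans G.numGroups_sq_mul_le
    refine le_trans ?_ ((Finset.card_fin n).trans_le hn)
    refine Finset.card_le_card_of_injOn Prod.snd (by simp) fun p hp q hq hpq => ?_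
    exact Prod.ext (Fin.ext ((h0 p hp).1.trans (h0 q hq).1.symm)) hpq

theorem card_protocol_nonempty_le {t : ℕ} (ht : t < 11) :
    (univ.filter fun p : Fin n × Fin n => (protocol t G p.1 p.2).Nonempty).card ≤
      G.darts.card := by
  interval_cases t
  · exact G.card_degreeMessage_le
  · exact G.card_groupsMessage_le
  · exact (card_route_nonempty_le _ _ _ _).trans G.card_blocks_le
  · exact (card_route_nonempty_le _ _ _ _).trans G.card_blocks_le
  · exact (card_route_nonempty_le _ _ _ _).trans G.card_blocks_le
  · exact (card_route_nonempty_le _ _ _ _).trans G.card_blocks_le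
  · exact (card_route_nonempty_le _ _ _ _).trans G.card_activeDarts_le
  · exact (card_route_nonempty_le _ _ _ _).trans G.card_activeDarts_le
  · exact (card_route_nonempty_le _ _ _ _).trans G.card_keptDarts_le_darts
  · exact (card_route_nonempty_le _ _ _ _).trans G.card_keptDarts_le_darts
  · exact (card_route_nonempty_le _ _ _ _).trans G.card_keptDarts_le_darts

theorem sum_blockSize (hg : 0 < g) (u : Fin n) :
    ∑ j ∈ range g, G.blockSize g u j = G.deg u := by
  unfold deg blockSize
  rw [Finset.card_eq_sum_card_fiberwise (f := fun v : Fin n => (v : ℕ) % g) (t := range g)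
    (fun v _ => by simpa using Nat.mod_lt _ hg)]
  simp only [Finset.filter_filter]

theorem blockSize_le (u : Fin n) (j : ℕ) : G.blockSize g u j ≤ n :=
  (Finset.card_le_univ _).trans_eq (Fintype.card_fin n)

theorem groupTable_of_lt (u : Fin n) {j : ℕ} (hj : j < g) :
    G.groupTable g (u % g) u j = G.blockSize g u j := by
  simp [groupTable, hj]

theorem sum_groupTable_row (hg : 0 < g) (i : ℕ) (u : Fin n) :
    ∑ j ∈ range g, G.groupTable g i u j = if (u : ℕ) % g = i then G.deg u else 0 := by
  split_ifs with h
  · rw [← G.sum_blockSize hg]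
    refine Finset.sum_congr rfl fun j hj => ?_
    simp [groupTable, h, Finset.mem_range.1 hj]
  · simp [groupTable, h]

theorem sum_groupTable (hg : 0 < g) (i : ℕ) :
    ∑ j ∈ range g, ∑ u, G.groupTable g i u j =
      ∑ u ∈ univ.filter (fun u : Fin n => (u : ℕ) % g = i), G.deg u := by
  rw [Finset.sum_comm, Finset.sum_filter]
  exact Finset.sum_congr rfl fun u _ => G.sum_groupTable_row hg i u

theorem isPlan_groupTable (hg : 0 < g) (i : ℕ) :
    IsPlan g (G.groupTable g i) (startTime g (G.groupTable g i)) := by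
  refine isPlan_startTime fun u => ?_
  rw [G.sum_groupTable_row hg]
  split_ifs
  · exact G.deg_le u
  · exact Nat.zero_le _

theorem blockStart_le {u : Fin n} {j : ℕ} (hj : j < g) : G.blockStart g u j ≤ 6 * n :=
  (G.isPlan_groupTable (by omega) _ u j hj).1

theorem rank_lt {u v : Fin n} (h : G.graph.Adj u v) : G.rank g u v < G.blockSize g u (v % g) := by
  refine Finset.card_lt_card (Finset.ssubset_iff_of_subset ?_ |>.2 ⟨v, ?_, ?_⟩)
  · intro x hx
    simp only [Finset.mem_filter, Finset.mem_univ, true_and] at hx ⊢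
    exact hx.1
  · simp [h]
  · simp

theorem rank_lt_rank {u v v' : Fin n} (h : G.graph.Adj u v) (hmod : (v : ℕ) % g = v' % g)
    (hlt : v < v') : G.rank g u v < G.rank g u v' := by
  refine Finset.card_lt_card (Finset.ssubset_iff_of_subset ?_ |>.2 ⟨v, ?_, ?_⟩)
  · intro x hx
    simp only [Finset.mem_filter, Finset.mem_univ, true_and] at hx ⊢
    exact ⟨⟨hx.1.1, hx.1.2.trans hmod⟩, hx.2.trans hlt⟩
  · simp [h, hmod, hlt]
  · simp

theorem slot_lt {p : Fin n × Fin n} (hp : p ∈ G.activeDarts g) : G.slot g p.1 p.2 < 7 * n := by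
  obtain ⟨h, hg⟩ := mem_activeDarts.1 hp
  have h1 := G.rank_lt (g := g) h
  have h2 := G.blockStart_le (u := p.1) (Nat.mod_lt (p.2 : ℕ) hg)
  have h3 := G.blockSize_le (g := g) p.1 (p.2 % g)
  unfold slot
  omega

/-- Darts of the same vertex or of the same part have different slots. -/
theorem eq_of_slot_eq {p q : Fin n × Fin n} (hp : p ∈ G.activeDarts g) (hq : q ∈ G.activeDarts g)
    (hmod : (p.1 : ℕ) % g = q.1 % g)
    (hrel : p.1 = q.1 ∨ G.dartPart g p.1 p.2 = G.dartPart g q.1 q.2)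
    (hslot : G.slot g p.1 p.2 = G.slot g q.1 q.2) : p = q := by
  obtain ⟨x, y⟩ := p
  obtain ⟨x', y'⟩ := q
  obtain ⟨hxy, hg⟩ := mem_activeDarts.1 hp
  obtain ⟨hxy', -⟩ := mem_activeDarts.1 hq
  simp only at *
  have hy := Nat.mod_lt (y : ℕ) hg
  have hy' := Nat.mod_lt (y' : ℕ) hg
  have h1 := G.rank_lt (g := g) hxy
  have h2 := G.rank_lt (g := g) hxy'
  -- Inside one block the ranks differ; two different blocks occupy disjoint intervals of the plan.
  by_cases hb : (x, (y : ℕ) % g) = (x', (y' : ℕ) % g)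
  · simp only [Prod.mk.injEq] at hb
    obtain ⟨rfl, hyy⟩ := hb
    unfold slot at hslot
    rw [hyy] at hslot
    rcases lt_trichotomy y y' with hlt | rfl | hlt
    · have := G.rank_lt_rank hxy hyy hlt
      omega
    · rfl
    · have := G.rank_lt_rank hxy' hyy.symm hlt
      omega
  · have hplan := (G.isPlan_groupTable hg (x % g) x _ hy).2 x' _ hy' hb (by
      unfold dartPart blockPart at hrel
      rwa [← hmod] at hrel)
    rw [G.groupTable_of_lt x hy, hmod, G.groupTable_of_lt x' hy', ← hmod] at hplan
    unfold slot blockStart at hslot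
    rw [← hmod] at hslot
    omega

theorem tableIndex_lt (hgn : g ≤ n) (u : Fin n) {j : ℕ} (hj : j < g) :
    tableIndex g u j < 2 * n := by
  have := Nat.div_mul_le_self (u : ℕ) g
  have := u.2
  unfold tableIndex
  omega

theorem eq_of_tableIndex_eq {u u' : Fin n} {j j' : ℕ} (hj : j < g) (hj' : j' < g)
    (hmod : (u : ℕ) % g = u' % g) (h : tableIndex g u j = tableIndex g u' j') :
    (u, j) = (u', j') := by
  have hg : 0 < g := by omega
  unfold tableIndex at h
  have h1 : (u : ℕ) / g = u' / g := by
    have := congrArg (· / g) h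
    simpa [Nat.mul_add_div hg, mul_comm _ g, Nat.div_eq_of_lt hj, Nat.div_eq_of_lt hj'] using this
  rw [h1] at h
  have h2 : u = u' := by
    ext
    rw [← Nat.div_add_mod (u : ℕ) g, ← Nat.div_add_mod (u' : ℕ) g, h1, hmod]
  rw [h2, Nat.add_left_cancel h]

theorem sum_deg_group_le (i : ℕ) :
    ∑ u ∈ univ.filter (fun u : Fin n => (u : ℕ) % g = i), G.deg u ≤ n * (n / g + 1) := by
  refine (Finset.sum_le_card_nsmul _ _ n fun u _ => G.deg_le u).trans ?_
  rw [smul_eq_mul, mul_comm]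
  exact Nat.mul_le_mul_left n (card_filter_mod_eq_le n g i)

theorem blockPart_lt_add {u : Fin n} {j : ℕ} (hj : j < g) : G.blockPart g u j <
    g + (∑ x ∈ univ.filter (fun x : Fin n => (x : ℕ) % g = u % g), G.deg x) / n := by
  rw [← G.sum_groupTable (by omega)]
  exact partIndex_lt hj

theorem blockPart_lt {u : Fin n} {j : ℕ} (hj : j < g) :
    G.blockPart g u j < g + n / g + 1 := by
  have h1 := G.blockPart_lt_add (u := u) hj
  have h2 := Nat.div_le_of_le_mul (G.sum_deg_group_le (g := g) (u % g))
  omega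

/-- All numbers are below $g(g + \lfloor n/g\rfloor + 1) \le g^2 + n + g \le 3n$. -/
theorem globalPart_lt (hsq : g * g ≤ n) {u : Fin n} {κ : ℕ} (hg : 0 < g)
    (hκ : κ < g + n / g + 1) : globalPart g u κ < 3 * n := by
  have h1 : (u : ℕ) % g + 1 ≤ g := Nat.mod_lt _ hg
  have h2 := Nat.mul_le_mul_right (g + n / g + 1) h1
  have h3 : g * (n / g) ≤ n := Nat.mul_div_le n g
  have h4 : g ≤ g * g := Nat.le_mul_self g
  unfold globalPart
  nlinarith

theorem eq_of_globalPart_eq {u u' : Fin n} {κ κ' : ℕ} (hκ : κ < g + n / g + 1)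
    (hκ' : κ' < g + n / g + 1) (h : globalPart g u κ = globalPart g u' κ') :
    (u : ℕ) % g = u' % g ∧ κ = κ' := by
  unfold globalPart at h
  set K := g + n / g + 1
  have hK : 0 < K := by omega
  have h1 : (u : ℕ) % g = u' % g := by
    have := congrArg (· / K) h
    simpa [Nat.mul_add_div hK, mul_comm _ K, Nat.div_eq_of_lt hκ, Nat.div_eq_of_lt hκ'] using this
  rw [h1] at h
  exact ⟨h1, Nat.add_left_cancel h⟩

/-- `P` fixes the group, where table indices are distinct and below `2 * n`, so the true bound is 2;
21 is the bound common to all rounds. -/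
theorem card_blocks_filter_le (hgn : g ≤ n) (P : Fin n × ℕ → Prop) [DecidablePred P] (y : Fin n)
    (hP : ∀ b b', P b → P b' → (b.1 : ℕ) % g = b'.1 % g) :
    ((blocks n g).filter fun b => P b ∧ relay g b.1 b.2 = y).card ≤ 21 := by
  refine (Finset.card_le_of_mod_eq (n := n) (L := 2) (r := y) _
    (fun b => tableIndex g b.1 b.2) ?_ ?_ ?_).trans (by norm_num)
  · rintro ⟨u, j⟩ hb ⟨u', j'⟩ hb' h
    obtain ⟨h1, h2, -⟩ := Finset.mem_filter.1 (Finset.mem_coe.1 hb)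
    obtain ⟨h1', h2', -⟩ := Finset.mem_filter.1 (Finset.mem_coe.1 hb')
    exact eq_of_tableIndex_eq (mem_blocks.1 h1) (mem_blocks.1 h1') (hP _ _ h2 h2') h
  · rintro ⟨u, j⟩ hb
    exact tableIndex_lt hgn u (mem_blocks.1 (Finset.mem_filter.1 hb).1)
  · rintro ⟨u, j⟩ hb
    exact congrArg Fin.val (Finset.mem_filter.1 hb).2.2

theorem card_source_filter_le {S : Finset (Fin n × Fin n)} (hS : S ⊆ G.activeDarts g)
    (x y : Fin n) :
    (S.filter fun p => p.1 = x ∧ G.middle g p.1 p.2 = y).card ≤ 21 := by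
  refine (Finset.card_le_of_mod_eq (n := n) (L := 7) (r := y) _
    (fun p => G.slot g p.1 p.2) ?_ ?_ ?_).trans (by norm_num)
  · intro p hp q hq h
    obtain ⟨h1, h2, -⟩ := Finset.mem_filter.1 (Finset.mem_coe.1 hp)
    obtain ⟨h1', h2', -⟩ := Finset.mem_filter.1 (Finset.mem_coe.1 hq)
    have heq : p.1 = q.1 := h2.trans h2'.symm
    exact G.eq_of_slot_eq (hS h1) (hS h1') (by rw [heq]) (Or.inl heq) h
  · intro p hp
    exact G.slot_lt (hS (Finset.mem_filter.1 hp).1)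
  · intro p hp
    exact congrArg Fin.val (Finset.mem_filter.1 hp).2.2

theorem dartPart_lt {p : Fin n × Fin n} (hp : p ∈ G.activeDarts g) :
    G.dartPart g p.1 p.2 < g + n / g + 1 :=
  G.blockPart_lt (Nat.mod_lt _ (mem_activeDarts.1 hp).2)

/-- The residues of slot and global part number are fixed by the link, so the dart is determined by
their quotients by `n`, with 7 and 3 possible values. -/
theorem card_holder_filter_le (hsq : g * g ≤ n) {S : Finset (Fin n × Fin n)}
    (hS : S ⊆ G.activeDarts g) (x y : Fin n) :
    (S.filter fun p => G.middle g p.1 p.2 = x ∧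
      holder g p.1 (G.dartPart g p.1 p.2) = y).card ≤ 21 := by
  have hn := x.pos
  have hcard : (range 7 ×ˢ range 3).card = 21 := by simp
  rw [← hcard]
  refine Finset.card_le_card_of_injOn (fun p => (G.slot g p.1 p.2 / n,
    globalPart g p.1 (G.dartPart g p.1 p.2) / n)) ?_ ?_
  · intro p hp
    have hp' := hS (Finset.mem_filter.1 hp).1
    have h1 := G.slot_lt hp'
    have h2 := globalPart_lt hsq (u := p.1) (mem_activeDarts.1 hp').2 (G.dartPart_lt hp')
    simp only [Finset.coe_product, Set.mem_prod, Finset.coe_range, Set.mem_Iio]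
    exact ⟨Nat.div_lt_of_lt_mul (by omega), Nat.div_lt_of_lt_mul (by omega)⟩
  · intro p hp q hq h
    obtain ⟨h1, h2, h3⟩ := Finset.mem_filter.1 (Finset.mem_coe.1 hp)
    obtain ⟨h1', h2', h3'⟩ := Finset.mem_filter.1 (Finset.mem_coe.1 hq)
    have hm : G.slot g p.1 p.2 % n = G.slot g q.1 q.2 % n := congrArg Fin.val (h2.trans h2'.symm)
    have hh : globalPart g p.1 (G.dartPart g p.1 p.2) % n =
        globalPart g q.1 (G.dartPart g q.1 q.2) % n := congrArg Fin.val (h3.trans h3'.symm)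
    simp only [Prod.mk.injEq] at h
    have hslot : G.slot g p.1 p.2 = G.slot g q.1 q.2 := by
      rw [← Nat.div_add_mod (G.slot g p.1 p.2) n, h.1, hm, Nat.div_add_mod]
    have hpart : globalPart g p.1 (G.dartPart g p.1 p.2) =
        globalPart g q.1 (G.dartPart g q.1 q.2) := by
      rw [← Nat.div_add_mod (globalPart g p.1 _) n, h.2, hh, Nat.div_add_mod]
    obtain ⟨h4, h5⟩ := eq_of_globalPart_eq (G.dartPart_lt (hS h1)) (G.dartPart_lt (hS h1')) hpart
    exact G.eq_of_slot_eq (hS h1) (hS h1') h4 (Or.inr h5) hslot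

theorem card_protocol_le {t : ℕ} (ht : t < 11) (x y : Fin n) :
    (protocol t G x y).card ≤ 21 := by
  have hsq := G.numGroups_sq_le
  have hgn : G.numGroups ≤ n := (Nat.le_mul_self _).trans hsq
  have hc : ∀ b b' : Fin n × ℕ, ∀ z, center G.numGroups b.1 = z → center G.numGroups b'.1 = z →
      (b.1 : ℕ) % G.numGroups = b'.1 % G.numGroups :=
    fun b b' z h h' => center_eq_iff _ _ |>.1 (h.trans h'.symm)
  interval_cases t
  · change (G.degreeMessage x y).card ≤ 21
    unfold degreeMessage
    split_ifs <;> simp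
  · change (G.groupsMessage x y).card ≤ 21
    unfold groupsMessage
    split_ifs <;> simp
  · refine (card_route_le _ _ _ _ _ _).trans (card_blocks_filter_le hgn (fun b => b.1 = x) y ?_)
    rintro b b' rfl h
    rw [h]
  · refine (card_route_le _ _ _ _ _ _).trans ?_
    simp only [and_comm (a := relay _ _ _ = _)]
    exact card_blocks_filter_le hgn (fun b => center G.numGroups b.1 = y) x
      fun b b' h h' => hc b b' y h h'
  · exact (card_route_le _ _ _ _ _ _).trans (card_blocks_filter_le hgn
      (fun b => center G.numGroups b.1 = x) y fun b b' h h' => hc b b' x h h')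
  · refine (card_route_le _ _ _ _ _ _).trans ?_
    simp only [and_comm (a := relay _ _ _ = _)]
    refine card_blocks_filter_le hgn (fun b => b.1 = y) x ?_
    rintro b b' rfl h
    rw [h]
  · exact (card_route_le _ _ _ _ _ _).trans (G.card_source_filter_le le_rfl x y)
  · exact (card_route_le _ _ _ _ _ _).trans (G.card_holder_filter_le hsq le_rfl x y)
  · refine (card_route_le _ _ _ _ _ _).trans ?_
    simp only [and_comm (a := holder _ _ _ = _)]
    exact G.card_holder_filter_le hsq (keptDarts_subset _) y x
  · refine (card_route_le _ _ _ _ _ _).trans ?_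
    simp only [and_comm (a := middle _ _ _ _ = _)]
    exact G.card_source_filter_le (keptDarts_subset _) y x
  · refine (card_route_le _ _ _ _ _ _).trans ?_
    refine (Finset.card_le_one.2 ?_).trans (by norm_num : 1 ≤ 21)
    intro p hp q hq
    obtain ⟨-, h1, h2⟩ := Finset.mem_filter.1 hp
    obtain ⟨-, h1', h2'⟩ := Finset.mem_filter.1 hq
    exact Prod.ext (h1.trans h1'.symm) (h2.trans h2'.symm)

/-- All items that may occur in messages. -/
noncomputable def itemBox (n c : ℕ) : Finset Item :=
  range (7 * n + 1) ×ˢ range (7 * n + 1) ×ˢ range (7 * n + 1) ×ˢ range (7 * n + 1) ×ˢ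
    Finset.Icc (-(n : ℤ) ^ c) ((n : ℤ) ^ c)

theorem mem_itemBox {n c : ℕ} {a : Item} : a ∈ itemBox n c ↔ a.1 ≤ 7 * n ∧ a.2.1 ≤ 7 * n ∧
    a.2.2.1 ≤ 7 * n ∧ a.2.2.2.1 ≤ 7 * n ∧ |a.2.2.2.2| ≤ (n : ℤ) ^ c := by
  simp only [itemBox, Finset.mem_product, Finset.mem_range, Nat.lt_succ_iff, Finset.mem_Icc, abs_le]

theorem protocol_subset_itemBox {c t : ℕ} (hG : ∀ e ∈ G.graph.edgeSet, |G.weight e| ≤ (n : ℤ) ^ c)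
    (ht : t < 11) (x y : Fin n) : protocol t G x y ⊆ itemBox n c := by
  have hsq := G.numGroups_sq_le
  have hgn : G.numGroups ≤ n := (Nat.le_mul_self _).trans hsq
  have hdn : n / G.numGroups ≤ n := Nat.div_le_self _ _
  have hn := x.pos
  have hv : ∀ z : Fin n, (z : ℕ) ≤ 7 * n := fun z => by omega
  have h0 : |(0 : ℤ)| ≤ (n : ℤ) ^ c := by
    rw [abs_zero]
    positivity
  have hblock : ∀ b ∈ blocks n G.numGroups, b.2 ≤ 7 * n ∧ G.blockSize G.numGroups b.1 b.2 ≤ 7 * n ∧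
      G.blockPart G.numGroups b.1 b.2 ≤ 7 * n ∧ G.blockStart G.numGroups b.1 b.2 ≤ 7 * n := by
    intro b hb
    have hb := mem_blocks.1 hb
    have h1 := G.blockSize_le (g := G.numGroups) b.1 b.2
    have h2 := G.blockPart_lt (u := b.1) hb
    have h3 := G.blockStart_le (u := b.1) hb
    omega
  have hdart : ∀ p ∈ G.activeDarts G.numGroups, G.dartPart G.numGroups p.1 p.2 ≤ 7 * n ∧
      |G.weight s(p.1, p.2)| ≤ (n : ℤ) ^ c := by
    intro p hp
    have h1 := G.dartPart_lt hp
    exact ⟨by omega, hG _ (mem_activeDarts.1 hp).1⟩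
  intro a ha
  rw [mem_itemBox]
  interval_cases t
  · change a ∈ G.degreeMessage x y at ha
    unfold degreeMessage at ha
    split_ifs at ha
    · have := G.deg_le x
      rw [Finset.mem_singleton.1 ha]
      exact ⟨by simp only; omega, Nat.zero_le _, Nat.zero_le _, Nat.zero_le _, h0⟩
    · exact absurd ha (Finset.notMem_empty _)
  · change a ∈ G.groupsMessage x y at ha
    unfold groupsMessage at ha
    split_ifs at ha
    · rw [Finset.mem_singleton.1 ha]
      exact ⟨by simp only; omega, Nat.zero_le _, Nat.zero_le _, Nat.zero_le _, h0⟩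
    · exact absurd ha (Finset.notMem_empty _)
  · obtain ⟨b, hb, -, -, rfl⟩ := mem_route.1 ha
    obtain ⟨h1, h2, h3, h4⟩ := hblock b hb
    exact ⟨h1, h2, Nat.zero_le _, Nat.zero_le _, h0⟩
  · obtain ⟨b, hb, -, -, rfl⟩ := mem_route.1 ha
    obtain ⟨h1, h2, h3, h4⟩ := hblock b hb
    exact ⟨hv _, h1, h2, Nat.zero_le _, h0⟩
  · obtain ⟨b, hb, -, -, rfl⟩ := mem_route.1 ha
    obtain ⟨h1, h2, h3, h4⟩ := hblock b hb
    exact ⟨hv _, h1, h3, h4, h0⟩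
  · obtain ⟨b, hb, -, -, rfl⟩ := mem_route.1 ha
    obtain ⟨h1, h2, h3, h4⟩ := hblock b hb
    exact ⟨h1, h3, h4, Nat.zero_le _, h0⟩
  · obtain ⟨p, hp, -, -, rfl⟩ := mem_route.1 ha
    obtain ⟨h1, h2⟩ := hdart p hp
    exact ⟨hv _, h1, Nat.zero_le _, Nat.zero_le _, h2⟩
  · obtain ⟨p, hp, -, -, rfl⟩ := mem_route.1 ha
    obtain ⟨h1, h2⟩ := hdart p hp
    exact ⟨hv _, hv _, h1, Nat.zero_le _, h2⟩
  · obtain ⟨p, hp, -, -, rfl⟩ := mem_route.1 ha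
    exact ⟨hv _, hv _, Nat.zero_le _, Nat.zero_le _, h0⟩
  · obtain ⟨p, hp, -, -, rfl⟩ := mem_route.1 ha
    exact ⟨hv _, Nat.zero_le _, Nat.zero_le _, Nat.zero_le _, h0⟩
  · obtain ⟨p, hp, -, -, rfl⟩ := mem_route.1 ha
    exact ⟨Nat.zero_le _, Nat.zero_le _, Nat.zero_le _, Nat.zero_le _, h0⟩

/-- With `l` as below, four coordinates cost `4 * l` bits each and the weight `(c + 2) * l`; one
more `l` absorbs the `+ 1`, and a message has 21 places. -/
theorem card_itemBox_pow_le (n c : ℕ) :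
    ((itemBox n c).card + 1) ^ 21 ≤ 2 ^ ((c + 19) * 21 * (Nat.log 2 n + 1)) := by
  set l := Nat.log 2 n + 1 with hl
  have hl1 : 1 ≤ l := by omega
  have hn : n < 2 ^ l := Nat.lt_pow_succ_log_self one_lt_two n
  have h1 : 7 * n + 1 ≤ 2 ^ (4 * l) :=
    calc 7 * n + 1 ≤ 2 ^ 3 * 2 ^ l := by omega
      _ = 2 ^ (3 + l) := (pow_add _ _ _).symm
      _ ≤ 2 ^ (4 * l) := Nat.pow_le_pow_right two_pos (by omega)
  have hc : n ^ c ≤ 2 ^ (c * l) := by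
    rw [mul_comm, pow_mul]
    exact Nat.pow_le_pow_left hn.le c
  have h2 : 2 * n ^ c + 1 ≤ 2 ^ ((c + 2) * l) :=
    calc 2 * n ^ c + 1 ≤ 2 ^ 2 * 2 ^ (c * l) := by
          have : 1 ≤ 2 ^ (c * l) := Nat.one_le_two_pow
          omega
      _ = 2 ^ (2 + c * l) := (pow_add _ _ _).symm
      _ ≤ 2 ^ ((c + 2) * l) := Nat.pow_le_pow_right two_pos (by nlinarith)
  have hIcc : (Finset.Icc (-(n : ℤ) ^ c) ((n : ℤ) ^ c)).card = 2 * n ^ c + 1 := by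
    rw [Int.card_Icc]
    have : ((n : ℤ) ^ c + 1 - -(n : ℤ) ^ c) = ((2 * n ^ c + 1 : ℕ) : ℤ) := by
      push_cast
      ring
    rw [this, Int.toNat_natCast]
  have h3 : (itemBox n c).card ≤ 2 ^ ((c + 18) * l) := by
    simp only [itemBox, Finset.card_product, Finset.card_range, hIcc]
    calc _ ≤ 2 ^ (4 * l) * (2 ^ (4 * l) * (2 ^ (4 * l) * (2 ^ (4 * l) * 2 ^ ((c + 2) * l)))) := by
          gcongr
      _ = 2 ^ ((c + 18) * l) := by
          simp only [← pow_add]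
          congr 1
          ring
  have h4 : (itemBox n c).card + 1 ≤ 2 ^ ((c + 19) * l) :=
    calc (itemBox n c).card + 1 ≤ 2 * 2 ^ ((c + 18) * l) := by
          have : 1 ≤ 2 ^ ((c + 18) * l) := Nat.one_le_two_pow
          omega
      _ = 2 ^ ((c + 18) * l + 1) := (pow_succ' _ _).symm
      _ ≤ 2 ^ ((c + 19) * l) := Nat.pow_le_pow_right two_pos (by nlinarith)
  calc ((itemBox n c).card + 1) ^ 21 ≤ (2 ^ ((c + 19) * l)) ^ 21 := Nat.pow_le_pow_left h4 21
    _ = 2 ^ ((c + 19) * 21 * l) := by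
        rw [← pow_mul]
        congr 1
        ring

end WeightedGraph

/-! ### The sparse subgraph -/

namespace WeightedGraph

open Classical CliqueAlgorithm

variable {n : ℕ} (G : WeightedGraph (Fin n)) {g : ℕ}

/-- If there are groups, the dart of an edge lies in some part, whose Kruskal forest contains the
light path. -/
theorem isBottleneckSubgraph_sparseGraph : G.IsBottleneckSubgraph G.sparseGraph where
  le _ _ h := h.1
  reachable x y hxy := by
    rcases Nat.eq_zero_or_pos G.numGroups with hg | hg
    · exact SimpleGraph.Adj.reachable
        ((SimpleGraph.fromEdgeSet_adj _).2 ⟨⟨⟨hxy, Or.inl hg⟩, le_rfl⟩, hxy.ne⟩)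
    · have hmem : (x, y, G.weight s(x, y)) ∈
          G.partDarts G.numGroups (x % G.numGroups) (G.dartPart G.numGroups x y) :=
        mem_partDarts.2 ⟨mem_activeDarts.2 ⟨hxy, hg⟩, rfl, rfl, rfl⟩
      refine (reachable_sparsePart _ hmem).mono (SimpleGraph.fromEdgeSet_mono ?_)
      rintro _ ⟨f, hf, hw, rfl⟩
      obtain ⟨h1, h2, h3, h4⟩ := mem_partDarts.1 (sparsePart_subset _ hf)
      refine ⟨⟨(mem_activeDarts.1 h1).1, Or.inr (Or.inl ?_)⟩, h4.trans_le hw⟩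
      refine Finset.mem_filter.2 ⟨h1, ?_⟩
      simp only
      rw [h2, h3, h4]
      exact hf

/-- All darts of a part go from group `i` to a single group `j`, so the part touches only these two
groups. -/
theorem card_sparsePart_partDarts_le (i κ : ℕ) :
    (sparsePart (G.partDarts g i κ)).card ≤ 2 * (n / g + 1) := by
  rcases (G.partDarts g i κ).eq_empty_or_nonempty with h | ⟨e₀, he₀⟩
  · have := sparsePart_subset (G.partDarts g i κ)
    rw [h, Finset.subset_empty] at this
    simp [h, this]
  · obtain ⟨-, hi₀, hκ₀, -⟩ := mem_partDarts.1 he₀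
    set j := (e₀.2.1 : ℕ) % g with hj
    refine (card_sparsePart_le _ (univ.filter (fun u : Fin n => (u : ℕ) % g = i) ∪
      univ.filter (fun u : Fin n => (u : ℕ) % g = j)) fun e he => ?_).trans ?_
    · obtain ⟨-, hi, hκ, -⟩ := mem_partDarts.1 he
      have hje : (e.2.1 : ℕ) % g = j := by
        unfold dartPart blockPart at hκ hκ₀
        rw [hi] at hκ
        rw [hi₀] at hκ₀
        exact eq_of_partIndex_eq (hκ.trans hκ₀.symm)
      simp [hi, hje]
    · refine (Finset.card_union_le _ _).trans ?_
      have h1 := card_filter_mod_eq_le n g i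
      have h2 := card_filter_mod_eq_le n g j
      omega

theorem card_keptDarts_le : (G.keptDarts g).card ≤ ∑ i ∈ range g,
    (g + (∑ u ∈ univ.filter (fun u : Fin n => (u : ℕ) % g = i), G.deg u) / n) *
      (2 * (n / g + 1)) := by
  set D : ℕ → ℕ := fun i => ∑ u ∈ univ.filter (fun u : Fin n => (u : ℕ) % g = i), G.deg u with hD
  calc (G.keptDarts g).card ≤ ((range g).biUnion fun i => (range (g + D i / n)).biUnion fun κ =>
        sparsePart (G.partDarts g i κ)).card := by
        refine Finset.card_le_card_of_injOn (fun p => (p.1, p.2, G.weight s(p.1, p.2))) ?_ ?_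
        · intro p hp
          obtain ⟨h1, h2⟩ := Finset.mem_filter.1 (Finset.mem_coe.1 hp)
          have hg := (mem_activeDarts.1 h1).2
          simp only [Finset.coe_biUnion, Set.mem_iUnion, Finset.mem_coe, Finset.mem_range]
          exact ⟨p.1 % g, Nat.mod_lt _ hg, G.dartPart g p.1 p.2,
            G.blockPart_lt_add (Nat.mod_lt _ hg), h2⟩
        · intro p _ q _ h
          simp only [Prod.mk.injEq] at h
          exact Prod.ext h.1 h.2.1
    _ ≤ ∑ i ∈ range g, ∑ κ ∈ range (g + D i / n), (sparsePart (G.partDarts g i κ)).card :=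
        Finset.card_biUnion_le.trans (Finset.sum_le_sum fun i _ => Finset.card_biUnion_le)
    _ ≤ ∑ i ∈ range g, ∑ κ ∈ range (g + D i / n), 2 * (n / g + 1) :=
        Finset.sum_le_sum fun i _ => Finset.sum_le_sum fun κ _ =>
          G.card_sparsePart_partDarts_le i κ
    _ = ∑ i ∈ range g, (g + D i / n) * (2 * (n / g + 1)) := by simp

theorem sum_deg_group_div_le (hg : 0 < g) :
    ∑ i ∈ range g, (∑ u ∈ univ.filter (fun u : Fin n => (u : ℕ) % g = i), G.deg u) / n ≤
      G.darts.card / n := by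
  rcases Nat.eq_zero_or_pos n with rfl | hn
  · simp
  · rw [Nat.le_div_iff_mul_le hn, Finset.sum_mul, card_darts_eq_sum_deg,
      ← Finset.sum_fiberwise_of_maps_to (s := univ) (t := range g)
        (g := fun u : Fin n => (u : ℕ) % g) (fun u _ => by simpa using Nat.mod_lt _ hg)]
    exact Finset.sum_le_sum fun i _ => Nat.div_mul_le_self _ _

theorem card_keptDarts_numGroups_le :
    (G.keptDarts G.numGroups).card ≤ 20 * (G.numGroups * n) := by
  set g := G.numGroups with hgdef
  rcases Nat.eq_zero_or_pos g with hg | hg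
  · rw [hg]
    simp [keptDarts, activeDarts]
  · refine G.card_keptDarts_le.trans ?_
    rw [← Finset.sum_mul, Finset.sum_add_distrib, Finset.sum_const, Finset.card_range, smul_eq_mul]
    have h1 := G.sum_deg_group_div_le hg
    -- Maximality of the square root gives $M/n < 4g^2$ up to rounding, so there are at most $g^2 +
    -- 4g^2$ parts.
    have h2 : G.darts.card / n < (g + 1) * (g + 1) := Nat.lt_succ_sqrt _
    have h3 : (g + 1) * (g + 1) ≤ 4 * (g * g) := by nlinarith
    have h4 : g * (n / g) ≤ n := Nat.mul_div_le n g
    have h5 : g ≤ n := (Nat.le_mul_self _).trans G.numGroups_sq_le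
    calc _ ≤ (5 * (g * g)) * (2 * (n / g + 1)) := Nat.mul_le_mul_right _ (by omega)
      _ = 10 * (g * (g * (n / g) + g)) := by ring
      _ ≤ 10 * (g * (n + n)) := by gcongr
      _ = 20 * (g * n) := by ring

theorem ncard_edgeSet_sparseGraph_le (hg : 0 < G.numGroups) :
    G.sparseGraph.edgeSet.ncard ≤ (G.keptDarts G.numGroups).card := by
  refine le_trans ?_ (Finset.card_image_le (f := fun p : Fin n × Fin n => s(p.1, p.2)))
  rw [← Set.ncard_coe_finset]
  refine Set.ncard_le_ncard ?_ (Finset.finite_toSet _)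
  intro e he
  induction e using Sym2.ind with
  | _ x y =>
  have hadj : G.sparseGraph.Adj x y := he
  rw [Finset.mem_coe, Finset.mem_image]
  rcases hadj.2 with h | h | h
  · omega
  · exact ⟨(x, y), h, rfl⟩
  · exact ⟨(y, x), h, Sym2.eq_swap⟩

theorem numEdges_sparseInstance_sq_le :
    G.sparseInstance.inst.numEdges ^ 2 ≤ 800 * (G.numEdges * n) := by
  have hle : G.sparseInstance.inst.numEdges ≤ G.numEdges :=
    Set.ncard_le_ncard (SimpleGraph.edgeSet_mono G.isBottleneckSubgraph_sparseGraph.le)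
      (Set.toFinite _)
  have hM := G.card_darts_eq_two_mul
  rcases Nat.eq_zero_or_pos G.numGroups with hg | hg
  -- Without groups nothing is removed, and $m \le n$ gives $m^2 \le mn$.
  · have hm : G.numEdges ≤ n := by
      have h1 := Nat.sqrt_eq_zero.1 hg
      rcases Nat.div_eq_zero_iff.1 h1 with hn | hn
      · have h2 := G.card_darts_le
        have h3 : n * n = 0 := by simp [hn]
        omega
      · omega
    nlinarith
  · have h1 : G.sparseInstance.inst.numEdges ≤ (G.keptDarts G.numGroups).card :=
      G.ncard_edgeSet_sparseGraph_le hg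
    have h2 := h1.trans G.card_keptDarts_numGroups_le
    have h3 := G.numGroups_sq_mul_le
    calc G.sparseInstance.inst.numEdges ^ 2 ≤ (20 * (G.numGroups * n)) ^ 2 :=
          Nat.pow_le_pow_left h2 2
      _ = 400 * (G.numGroups * G.numGroups * n * n) := by ring
      _ ≤ 400 * (2 * G.numEdges * n) := by
          rw [← hM]
          gcongr
      _ = 800 * (G.numEdges * n) := by ring

theorem numEdges_sparseInstance_le : (G.sparseInstance.inst.numEdges : ℝ) ≤
    (40 : ℕ) * Real.sqrt ((G.numEdges : ℝ) * n) := by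
  have h : (G.sparseInstance.inst.numEdges : ℝ) ^ 2 ≤ 800 * ((G.numEdges : ℝ) * n) := by
    exact_mod_cast G.numEdges_sparseInstance_sq_le
  refine abs_le_of_sq_le_sq' ?_ (by positivity) |>.2
  rw [mul_pow, Real.sq_sqrt (by positivity)]
  have : 0 ≤ (G.numEdges : ℝ) * n := by positivity
  push_cast
  linarith

theorem load_sparseInstance_le (v : Fin n) : G.sparseInstance.load v ≤ n := by
  have h : (univ.filter fun a : Fin n => a = v) = {v} := by
    ext
    simp
  have hload : G.sparseInstance.load v = (G.sparseGraph.neighborSet v).ncard := by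
    change ∑ a ∈ univ.filter (fun a : Fin n => a = v), (G.sparseGraph.neighborSet a).ncard = _
    rw [h, Finset.sum_singleton]
  rw [hload]
  refine (Set.ncard_le_ncard (Set.subset_univ _) (Set.toFinite _)).trans ?_
  rw [Set.ncard_univ, Nat.card_eq_fintype_card, Fintype.card_fin]

theorem recover_sparseInstance (T : Finset (Sym2 (Fin n))) : G.sparseInstance.recover T = T := by
  change T.biUnion (fun e => (some e).toFinset) = T
  simp

end WeightedGraph

/-! ### The reduction. -/

open CliqueAlgorithm WeightedGraph in
theorem mainTheorem4 :
    ∃ C : ℕ, ∀ c : ℕ, ∃ b : ℕ, ∀ n : ℕ,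
      ∃ A : CliqueAlgorithm n (b * (Nat.log 2 n + 1)) (Fin n → Option ℤ) (LocalView n),
        A.rounds ≤ C ∧
        ∀ G : WeightedGraph (Fin n), (∀ e ∈ G.graph.edgeSet, |G.weight e| ≤ (n : ℤ) ^ c) →
          A.messageCount G.localInput ≤ C * G.numEdges ∧
          ∃ D : HostedInstance n,
            (∀ v, A.result G.localInput v = D.localView v) ∧
            D.size ≤ C * n ∧
            (D.inst.numEdges : ℝ) ≤ C * Real.sqrt ((G.numEdges : ℝ) * n) ∧
            (∀ v, D.load v ≤ C * n) ∧
            (∀ e ∈ D.inst.graph.edgeSet, |D.inst.weight e| ≤ C * (n : ℤ) ^ c) ∧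
            (G.graph.Connected → D.inst.graph.Connected) ∧
            ∀ T, D.inst.IsMinSpanningForest T → G.IsMinSpanningForest (D.recover T) := by
  -- The constant 40 covers 11 rounds, $11 \cdot 2m$ messages and $\sqrt{800}$.
  refine ⟨40, fun c => ⟨(c + 19) * 21, fun n => ?_⟩⟩
  -- The schedule ranges only over graphs with bounded weights, so that all items fit into `itemBox
  -- n c`.
  let 𝒢 : Type := {G : WeightedGraph (Fin n) // ∀ e ∈ G.graph.edgeSet, |G.weight e| ≤ (n : ℤ) ^ c}
  have : Nonempty (LocalView n) := ⟨⟨∅, ∅⟩⟩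
  obtain ⟨A, hR, hA⟩ := exists_of_finset_schedule (itemBox n c) (card_itemBox_pow_le n c)
    (fun G : 𝒢 => G.1.localInput) 11 (fun t G => protocol t G.1)
    (fun G v => G.1.sparseInstance.localView v)
    (fun t ht G u v => G.1.protocol_subset_itemBox G.2 ht u v)
    (fun t ht G u v => G.1.card_protocol_le ht u v)
    (fun t ht G G' u h v => protocol_local ht h v)
    (fun G G' u h => localView_local h)
  refine ⟨A, by omega, fun G hG => ⟨?_, G.sparseInstance, (hA ⟨G, hG⟩).2, ?_,
    G.numEdges_sparseInstance_le, ?_, ?_, ?_, ?_⟩⟩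
  · rw [(hA ⟨G, hG⟩).1]
    refine (Finset.sum_le_card_nsmul _ _ G.darts.card fun t ht =>
      G.card_protocol_nonempty_le (Finset.mem_range.1 ht)).trans ?_
    rw [G.card_darts_eq_two_mul, Finset.card_range, smul_eq_mul]
    omega
  · change n ≤ 40 * n
    omega
  · intro v
    have := G.load_sparseInstance_le v
    omega
  · intro e he
    have h1 := hG e (SimpleGraph.edgeSet_mono G.isBottleneckSubgraph_sparseGraph.le he)
    have h2 : (0 : ℤ) ≤ (n : ℤ) ^ c := by positivity
    refine h1.trans ?_
    push_cast
    linarith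
  · intro hconn
    have := hconn.nonempty
    change G.sparseGraph.Connected
    exact ⟨fun u v => G.isBottleneckSubgraph_sparseGraph.reachable_of_reachable
      (hconn.preconnected u v)⟩
  · intro T hT
    refine (congrArg G.IsMinSpanningForest (G.recover_sparseInstance T)).mpr ?_
    exact G.isBottleneckSubgraph_sparseGraph.isMinSpanningForest hT
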